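/- **Notation.** For a real matrix $B$ with linearly independent columns let $\mathcal L(B)=\{Bz : z \text{ integral}\}$; for a lattice $\Lambda$ let $\Lambda^*=\{y\in\operatorname{span}\Lambda : \langle x,y\rangle\in\mathbb Z\ \forall x\in\Lambda\}$ and, for $\epsilon\in(0,1)$, let $\eta_\epsilon(\Lambda)=\inf\{t>0:\sum_{y\in\Lambda^*}e^{-\pi t^2\|y\|^2}\le 1+\epsilon\}$. For a positive definite matrix $\Sigma$ let $D_{S,\sqrt\Sigma}$ be the distribution on the lattice coset $S$ with probabilities proportional to $e^{-\pi x^t\Sigma^{-1}x}$, and $D_{S,s}=D_{S,\sqrt{s^2I}}$. $s_1(T)$ is the largest singular value of $T$, $\mathbb Z_Q=\mathbb Z/Q\mathbb Z$, $U(\cdot)$ is the uniform distribution, and the statistical distance of two discrete distributions $\mu,\nu$ is $\tfrac12\sum_a|\mu(a)-\nu(a)|$. A function $f:\mathbb N\to\mathbb R$ is negligible if $k^c f(k)\to0$ for every $c\in\mathbb N$. **Setting.** Let $Q\ge1$, let $P,\mathbf Q\in\mathbb Z^{n\times n}$ with $P\mathbf Q=Q\cdot I_n$, and let $A\in\mathbb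 Z_Q^{n\times m}$, $T\in\mathbb Z^{m\times n}$ with $AT=P \bmod Q$. Fix a deterministic decoder for $\mathcal L(P)$: it maps $u'\in\mathbb Z^n$ to $(c,e)\in\mathbb Z^n\times\mathbb Z^n$ with $u'-e=Pc$, where $e=:(u' \bmod \mathcal L(P))$ depends only on the coset $u'+\mathcal L(P)$. A vector of $\mathbb Z_Q^n$ is decoded through integer representatives (their choice is immaterial, as $Q\mathbb Z^n\subseteq\mathcal L(P)$). Let $\chi_e$ be the distribution of $(v\bmod\mathcal L(P))$ for $v\leftarrow U(\mathbb Z_Q^n)$. For $r>0$, $s>0$ with $\Sigma_p:=s^2I_m-r^2TT^t$ positive definite, $\mathrm{PreSamp}(A,T,u,r,s)$ samples $p\leftarrow D_{\mathbb Z^m,\sqrt{\Sigma_p}}$, decodes $u'=u-Ap\bmod Q$ to $(c,e)$, samples $x'\leftarrow D_{\mathcal L(\mathbf Q)+c,\,r}$ and outputs $x=p+Tx'$. **Theorem.** Let $\epsilon:\mathbb N\to(0,1)$ be a negligible function of the security parameter $k$, and let the dimension be polynomially bounded, $n\le d(k)$ for a fixed polynomial $d$. There is a negligible function $\delta$, depending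 only on $\epsilon$ and $d$, such that the following holds for every $k$, all $n\le d(k)$, all $m$, all $Q,P,\mathbf Q,A,T$ and decoders as above, and all $r,s>0$ with $$s^2\ge\bigl(r^2+\eta_{\epsilon(k)}(\mathbb Z^n)^2\bigr)\bigl(s_1(T)^2+1\bigr),\qquad r\ge\eta_{\epsilon(k)}(\mathcal L(\mathbf Q)).$$ The matrix $\Sigma_p$ is positive definite (so $\mathrm{PreSamp}$ is defined), and the two distributions $$\{(A,x,u,e): u\leftarrow U(\mathbb Z_Q^n),\ x\leftarrow\mathrm{PreSamp}(A,T,u,r,s),\ e=u-Ax\bmod Q\},$$ $$\{(A,x,u,e): x\leftarrow D_{\mathbb Z^m,s},\ e\leftarrow\chi_e,\ u=Ax+e\bmod Q\},$$ where $e$ is read modulo $Q$ in both tuples, are at statistical distance at most $\delta(k)$. -/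

import Mathlib

open scoped ENNReal

noncomputable section

namespace CompactGadget

/-! ### Lattices and the smoothing parameter -/

/-- The lattice `L(B) = {B z | z ∈ ℤⁿ}` generated by the columns of `B`. -/
def lattice {m n : ℕ} (B : Matrix (Fin m) (Fin n) ℝ) : Set (EuclideanSpace ℝ (Fin m)) :=
  {x | ∃ z : Fin n → ℤ, x = WithLp.toLp 2 (B.mulVec (fun i => (z i : ℝ)))}

/-- The dual lattice `Λ* = {y ∈ span Λ | ⟨x, y⟩ ∈ ℤ for all x ∈ Λ}`. -/
def dualLattice {m : ℕ} (L : Set (EuclideanSpace ℝ (Fin m))) : Set (EuclideanSpace ℝ (Fin m)) :=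
  {y | y ∈ Submodule.span ℝ L ∧ ∀ x ∈ L, ∃ k : ℤ, inner ℝ x y = (k : ℝ)}

/-- `ρ(t · S) = ∑_{y ∈ S} exp (-π ‖t y‖²)`, with values in `[0, ∞]`. -/
def gaussianSum {m : ℕ} (t : ℝ) (S : Set (EuclideanSpace ℝ (Fin m))) : ℝ≥0∞ :=
  ∑' y : S, ENNReal.ofReal (Real.exp (-Real.pi * ‖t • (y : EuclideanSpace ℝ (Fin m))‖ ^ 2))

/-- The smoothing parameter `η_ε(Λ)`: the least `t > 0` with `ρ(t · Λ*) ≤ 1 + ε`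
(the infimum is attained for every lattice of positive dimension). -/
def smoothing {m : ℕ} (ε : ℝ) (L : Set (EuclideanSpace ℝ (Fin m))) : ℝ :=
  sInf {t : ℝ | 0 < t ∧ gaussianSum t (dualLattice L) ≤ ENNReal.ofReal (1 + ε)}

/-- The integer lattice `ℤⁿ`. -/
def integerLattice (n : ℕ) : Set (EuclideanSpace ℝ (Fin n)) :=
  lattice (1 : Matrix (Fin n) (Fin n) ℝ)

/-- The largest singular value `s₁(T) = max_{x ≠ 0} ‖T x‖ / ‖x‖`, i.e. the `ℓ²` operator norm. -/
def s₁ {m n : ℕ} (T : Matrix (Fin m) (Fin n) ℝ) : ℝ :=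
  ‖(Matrix.toEuclideanLin T).toContinuousLinearMap‖

/-! ### Discrete Gaussian distributions -/

/-- `ρ_{√Σ}(x) = exp (-π xᵗ Σ⁻¹ x)` at integer points `x`. -/
def gaussianWeight {m : ℕ} (C : Matrix (Fin m) (Fin m) ℝ) (x : Fin m → ℤ) : ℝ≥0∞ :=
  ENNReal.ofReal (Real.exp (-Real.pi *
    dotProduct (fun i => (x i : ℝ)) (C⁻¹.mulVec (fun i => (x i : ℝ)))))

theorem tsum_pi_prod (f : ℤ → ℝ≥0∞) (m : ℕ) :
    ∑' x : Fin m → ℤ, ∏ i, f (x i) = (∑' k, f k) ^ m := by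
  induction m with
  | zero => simp
  | succ m ih =>
    rw [← (Fin.consEquiv (fun _ : Fin (m + 1) => ℤ)).tsum_eq, ENNReal.tsum_prod', pow_succ',
      ← ih, ← ENNReal.tsum_mul_right]
    refine tsum_congr fun k => ?_
    rw [← ENNReal.tsum_mul_left]
    refine tsum_congr fun x => ?_
    simp [Fin.prod_univ_succ, Fin.consEquiv]

theorem tsum_exp_sq_ne_top (a : ℝ) (ha : 0 < a) :
    ∑' k : ℤ, ENNReal.ofReal (Real.exp (-a * (k : ℝ) ^ 2)) ≠ ∞ := by
  apply Summable.tsum_ofReal_ne_top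
  have h : Summable fun n : ℕ => Real.exp (-a * (n : ℝ) ^ 2) := by
    refine Summable.of_nonneg_of_le (fun _ => (Real.exp_pos _).le) (fun n => ?_)
      (Real.summable_exp_nat_mul_iff.mpr (neg_neg_of_pos ha))
    apply Real.exp_le_exp.mpr
    have : (n : ℝ) ≤ (n : ℝ) ^ 2 := by exact_mod_cast Nat.le_self_pow two_ne_zero n
    nlinarith
  exact Summable.of_nat_of_neg (by simpa using h) (by simpa using h)

theorem exists_le_quadratic {m : ℕ} {M : Matrix (Fin m) (Fin m) ℝ} (hM : M.PosDef) :
    ∃ c : ℝ, 0 < c ∧ ∀ v : Fin m → ℝ, c * ∑ i, v i ^ 2 ≤ dotProduct v (M.mulVec v) := by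
  let q : EuclideanSpace ℝ (Fin m) → ℝ := fun v => dotProduct v.ofLp (M.mulVec v.ofLp)
  have hq : Continuous q := by
    simp only [q, dotProduct, Matrix.mulVec]
    fun_prop
  have hpos : ∀ v : EuclideanSpace ℝ (Fin m), v ≠ 0 → 0 < q v := fun v hv => by
    have := hM.dotProduct_mulVec_pos (x := v.ofLp) (by simpa using hv)
    simpa [q] using this
  rcases isEmpty_or_nonempty (Fin m) with hm | hm
  · exact ⟨1, one_pos, fun v => by simp [dotProduct]⟩
  obtain ⟨w, hw, hmin⟩ := (isCompact_sphere (0 : EuclideanSpace ℝ (Fin m)) 1).exists_isMinOn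
    (NormedSpace.sphere_nonempty.mpr zero_le_one) hq.continuousOn
  have hw0 : w ≠ 0 := by
    rintro rfl
    simp at hw
  refine ⟨q w, hpos w hw0, fun v => ?_⟩
  let x : EuclideanSpace ℝ (Fin m) := WithLp.toLp 2 v
  have hn : ∑ i, v i ^ 2 = ‖x‖ ^ 2 := by
    simp [x, EuclideanSpace.norm_sq_eq]
  by_cases hx : x = 0
  · have : v = 0 := by simpa [x] using hx
    simp [this]
  have hx' : ‖x‖ ≠ 0 := norm_ne_zero_iff.mpr hx
  have h1 : q w ≤ q (‖x‖⁻¹ • x) := hmin (by simp [norm_smul, hx'])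
  have h2 : q (‖x‖⁻¹ • x) = ‖x‖⁻¹ ^ 2 * dotProduct v (M.mulVec v) := by
    simp [q, x, Matrix.mulVec_smul, dotProduct_smul, smul_dotProduct]
    ring
  rw [hn]
  rw [h2] at h1
  calc q w * ‖x‖ ^ 2 ≤ ‖x‖⁻¹ ^ 2 * dotProduct v (M.mulVec v) * ‖x‖ ^ 2 := by gcongr
    _ = dotProduct v (M.mulVec v) := by field_simp

theorem tsum_gaussianWeight_ne_top {m : ℕ} {C : Matrix (Fin m) (Fin m) ℝ} (hC : C.PosDef) :
    ∑' x, gaussianWeight C x ≠ ∞ := by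
  obtain ⟨c, hc, h⟩ := exists_le_quadratic hC.inv
  have hle : ∀ x : Fin m → ℤ, gaussianWeight C x ≤
      ∏ i, ENNReal.ofReal (Real.exp (-(Real.pi * c) * (x i : ℝ) ^ 2)) := fun x => by
    rw [← ENNReal.ofReal_prod_of_nonneg (fun _ _ => (Real.exp_pos _).le), ← Real.exp_sum,
      ← Finset.mul_sum]
    apply ENNReal.ofReal_le_ofReal
    apply Real.exp_le_exp.mpr
    have := mul_le_mul_of_nonneg_left (h fun i => (x i : ℝ)) Real.pi_pos.le
    linarith
  refine ne_top_of_le_ne_top ?_ (ENNReal.tsum_le_tsum hle)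
  rw [tsum_pi_prod (fun k : ℤ => ENNReal.ofReal (Real.exp (-(Real.pi * c) * (k : ℝ) ^ 2)))]
  exact ENNReal.pow_ne_top (tsum_exp_sq_ne_top _ (by positivity))

/-- The discrete Gaussian `D_{S, √Σ}` on a nonempty set `S` of integer points (a lattice or a
lattice coset): the point `x ∈ S` has probability `ρ_{√Σ}(x) / ρ_{√Σ}(S)`. -/
def discreteGaussian {m : ℕ} (C : Matrix (Fin m) (Fin m) ℝ) (hC : C.PosDef)
    (S : Set (Fin m → ℤ)) (hS : S.Nonempty) : PMF (Fin m → ℤ) :=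
  PMF.normalize (S.indicator (gaussianWeight C))
    (by
      obtain ⟨x, hx⟩ := hS
      intro h
      have := ENNReal.tsum_eq_zero.mp h x
      rw [Set.indicator_of_mem hx, gaussianWeight, ENNReal.ofReal_eq_zero] at this
      exact absurd this (not_le.mpr (Real.exp_pos _)))
    (ne_top_of_le_ne_top (tsum_gaussianWeight_ne_top hC)
      (ENNReal.tsum_le_tsum fun x => Set.indicator_le_self _ _ x))

theorem posDef_sq_smul_one {m : ℕ} {r : ℝ} (hr : 0 < r) :
    (r ^ 2 • (1 : Matrix (Fin m) (Fin m) ℝ)).PosDef :=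
  Matrix.PosDef.one.smul (by positivity)

/-- The spherical discrete Gaussian `D_{S, r}`. -/
def sphericalGaussian {m : ℕ} (r : ℝ) (hr : 0 < r) (S : Set (Fin m → ℤ)) (hS : S.Nonempty) :
    PMF (Fin m → ℤ) :=
  discreteGaussian (r ^ 2 • 1) (posDef_sq_smul_one hr) S hS

/-! ### Statistical distance -/

/-- The statistical distance of two discrete distributions. -/
def statDist {α : Type*} (μ ν : PMF α) : ℝ :=
  (1 / 2) * ∑' a, |(μ a).toReal - (ν a).toReal|

/-- Negligible functions of the security parameter: `k ^ c * f k → 0` for every `c`. -/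
def Negligible (f : ℕ → ℝ) : Prop :=
  Asymptotics.SuperpolynomialDecay Filter.atTop (fun k : ℕ => (k : ℝ)) f

/-! ### The gadget, the semi-random sampler and the approximate preimage sampler -/

/-- Representatives in `ℤ` of a vector over `ℤ_q`. They are only fed to a decoder for a lattice
`L(P)` containing `q ℤⁿ`, so for the error the choice of representatives is immaterial, and
another choice moves the vector `c` within its coset modulo `L(Q)` (when `P Q = q I`). -/
def lift {n q : ℕ} (v : Fin n → ZMod q) : Fin n → ℤ := fun i => ((v i).val : ℤ)

/-- Reduction of an integer vector modulo `q`. -/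
def reduce {n : ℕ} (q : ℕ) (v : Fin n → ℤ) : Fin n → ZMod q := fun i => (v i : ZMod q)

/-- A deterministic decoder for the lattice `L(P)`: on input `u` it returns `(c, e)` with
`u - e = P c`, and the error `e = (u mod L(P))` depends only on the coset `u + L(P)`. -/
structure Decoder {n : ℕ} (P : Matrix (Fin n) (Fin n) ℤ) where
  /-- the coefficient vector `c` -/
  coeff : (Fin n → ℤ) → (Fin n → ℤ)
  /-- the error `e = (u mod L(P))` -/
  err : (Fin n → ℤ) → (Fin n → ℤ)
  decode : ∀ u, u - err u = P.mulVec (coeff u)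
  err_coset : ∀ u z, err (u + P.mulVec z) = err u

/-- The coset `L(Q) + c`. -/
def cosetOf {n : ℕ} (Q : Matrix (Fin n) (Fin n) ℤ) (c : Fin n → ℤ) : Set (Fin n → ℤ) :=
  {x | ∃ v : Fin n → ℤ, x = Q.mulVec v + c}

theorem cosetOf_nonempty {n : ℕ} (Q : Matrix (Fin n) (Fin n) ℤ) (c : Fin n → ℤ) :
    (cosetOf Q c).Nonempty :=
  ⟨c, 0, by simp⟩

/-- The semi-random gadget sampler: decode the target `u'` to `(c, e)`, then sample from
`D_{L(Q) + c, r}`. -/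
def gadgetSample {n q : ℕ} {P : Matrix (Fin n) (Fin n) ℤ} (dec : Decoder P)
    (Q : Matrix (Fin n) (Fin n) ℤ) (r : ℝ) (hr : 0 < r) (u' : Fin n → ZMod q) :
    PMF (Fin n → ℤ) :=
  sphericalGaussian r hr (cosetOf Q (dec.coeff (lift u'))) (cosetOf_nonempty _ _)

/-- The covariance `Σ_p = s² I - r² T Tᵗ` of the perturbation. -/
def perturbationCov {m n : ℕ} (T : Matrix (Fin m) (Fin n) ℤ) (r s : ℝ) :
    Matrix (Fin m) (Fin m) ℝ :=
  s ^ 2 • 1 - r ^ 2 • (T.map (Int.cast : ℤ → ℝ) * (T.map (Int.cast : ℤ → ℝ)).transpose)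

/-- The approximate preimage sampler `PreSamp(A, T, u, r, s)`, which requires
`s² I ≻ r² T Tᵗ`: sample `p ← D_{ℤᵐ, √Σ_p}`, set `u' = u - A p mod q`, sample
`x' ← gadgetSample u'`, and return `p + T x'`. -/
def preSamp {m n q : ℕ} {P : Matrix (Fin n) (Fin n) ℤ} (dec : Decoder P)
    (Q : Matrix (Fin n) (Fin n) ℤ) (A : Matrix (Fin n) (Fin m) (ZMod q))
    (T : Matrix (Fin m) (Fin n) ℤ) (r s : ℝ) (hr : 0 < r) (hC : (perturbationCov T r s).PosDef)
    (u : Fin n → ZMod q) : PMF (Fin m → ℤ) := do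
  let p ← discreteGaussian (perturbationCov T r s) hC Set.univ Set.univ_nonempty
  let u' := u - A.mulVec (reduce q p)
  let x' ← gadgetSample dec Q r hr u'
  return p + T.mulVec x'

/-- The error distribution `χ_e`: the law of `(v mod L(P))` for uniform `v` in `ℤ_qⁿ`. -/
def errorDist {n : ℕ} (q : ℕ) [NeZero q] {P : Matrix (Fin n) (Fin n) ℤ} (dec : Decoder P) :
    PMF (Fin n → ℤ) :=
  (PMF.uniformOfFintype (Fin n → ZMod q)).map fun v => dec.err (lift v)

/-- Tuples `(A, x, u, e)`; the entries `u` and `e` are vectors modulo `q`. (Distinct errors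
`e = (v mod L(P))` are distinct modulo `L(P)`, hence modulo `q` when `P Q = q I`, so that
`e mod q` determines the integer vector `e`.) -/
abbrev Transcript (m n q : ℕ) : Type :=
  Matrix (Fin n) (Fin m) (ZMod q) × (Fin m → ℤ) × (Fin n → ZMod q) × (Fin n → ZMod q)

/-- `u ← U(ℤ_qⁿ)`, `x ← PreSamp(A, T, u, r, s)`, `e = u - A x mod q`. -/
def realDist {m n q : ℕ} [NeZero q] {P : Matrix (Fin n) (Fin n) ℤ} (dec : Decoder P)
    (Q : Matrix (Fin n) (Fin n) ℤ) (A : Matrix (Fin n) (Fin m) (ZMod q))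
    (T : Matrix (Fin m) (Fin n) ℤ) (r s : ℝ) (hr : 0 < r) (hC : (perturbationCov T r s).PosDef) :
    PMF (Transcript m n q) := do
  let u ← PMF.uniformOfFintype (Fin n → ZMod q)
  let x ← preSamp dec Q A T r s hr hC u
  return (A, x, u, u - A.mulVec (reduce q x))

/-- `x ← D_{ℤᵐ, s}`, `e ← χ_e`, `u = A x + e mod q`; the trapdoor is not used. -/
def simulatedDist {m n q : ℕ} [NeZero q] {P : Matrix (Fin n) (Fin n) ℤ} (dec : Decoder P)
    (A : Matrix (Fin n) (Fin m) (ZMod q)) (s : ℝ) (hs : 0 < s) : PMF (Transcript m n q) := do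
  let x ← sphericalGaussian s hs Set.univ Set.univ_nonempty
  let e ← errorDist q dec
  return (A, x, A.mulVec (reduce q x) + reduce q e, reduce q e)

end CompactGadget

end

noncomputable section

namespace CompactGadget

open Matrix MeasureTheory

/-! ### Poisson summation for Gaussians of quadratic forms -/

/-! The whole argument runs on one-sided pointwise bounds `μ a ≤ (1 + δ) * ν a`. Such a bound gives
statistical distance at most `δ`, because both sides have mass one (`statDist_le_of_apply_le`), and
it survives a common randomised continuation (`bind_apply_le`, `bind_apply_le_of_forall`).

For uniform `u`, the target `v = u - A p` is uniform and independent of `p`. If `v` decodes with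
error `e` and `x'` is the gadget sample, then `v = e + P x'` modulo `q`. Since `A T = P`, this gives
`u = A (p + T x') + e`, so the real transcript is a function of `p + T x'` and `e` (`realDist_eq`).
Two replacements then lead to the simulation.

Gadget (`gadgetJoint_apply_le`): `(x', e)` is replaced by independent samples from `D_{ℤⁿ, r}` and
`χ_e`. For a fixed error `e`, the cosets `L(Q) + c` belonging to targets with that error partition
`ℤⁿ`. They have nearly equal Gaussian mass since `r` exceeds the smoothing parameter of `L(Q)`.

Convolution (`convolution_apply_le`): `p + T x'` is replaced by `D_{ℤᵐ, s}`. Completing the square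
(`gaussian_fiber_complete_square`) writes the law of `p + T x'` at `x` as the weight of `D_{ℤᵐ, s}`
times a Gaussian sum over a shift of `ℤⁿ` depending on `x`, with precision matrix `M = r⁻² I + Tᵗ
Σ_p⁻¹ T`. This sum is nearly independent of the shift once the dual sum, governed by `M⁻¹`, is close
to one.

Both near-constancy statements are Poisson summation (`exists_tsum_gaussian_shift_bounds`). The
hypotheses only yield `M⁻¹ ≥ η²/2`, with `η` the smoothing parameter of `ℤⁿ`. The lost factor `√2`
is paid for by the product structure of the Gaussian sum over `ℤⁿ`: it turns the error `ε` into a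
multiple of `√(N ε)` with `n ≤ N` (`tsum_exp_half_le`). This is negligible because `N` is polynomial
in `k`. -/

theorem exists_eq_transpose_mul_self {n : ℕ} {M : Matrix (Fin n) (Fin n) ℝ} (hM : M.PosDef) :
    ∃ B : Matrix (Fin n) (Fin n) ℝ, B.det ≠ 0 ∧ M = Bᵀ * B := by
  open scoped MatrixOrder Matrix.Norms.L2Operator in
  obtain ⟨B, hB⟩ := CStarAlgebra.nonneg_iff_eq_star_mul_self.mp hM.posSemidef.nonneg
  have hB' : M = Bᵀ * B := by rw [hB, star_eq_conjTranspose, conjTranspose_eq_transpose_of_trivial]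
  refine ⟨B, fun h => ?_, hB'⟩
  have := hM.det_pos
  rw [hB', det_mul, h, mul_zero] at this
  exact lt_irrefl _ this

theorem integral_comp_mulVec {n : ℕ} {B : Matrix (Fin n) (Fin n) ℝ} (hB : B.det ≠ 0)
    {g : (Fin n → ℝ) → ℂ} (hg : Continuous g) :
    ∫ x, g (B *ᵥ x) = |B.det⁻¹| * ∫ x, g x := by
  have hc : Continuous (toLin' B) := LinearMap.continuous_of_finiteDimensional _
  have h := integral_map (μ := volume) hc.aemeasurable (f := g) hg.aestronglyMeasurable
  rw [Real.map_matrix_volume_pi_eq_smul_volume_pi hB, integral_smul_measure] at h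
  simp only [toLin'_apply] at h
  rw [← h, ENNReal.toReal_ofReal (abs_nonneg _)]
  simp

theorem integrable_comp_mulVec {n : ℕ} {B : Matrix (Fin n) (Fin n) ℝ} (hB : B.det ≠ 0)
    {g : (Fin n → ℝ) → ℂ} (hg : Continuous g) (hi : Integrable g) :
    Integrable fun x => g (B *ᵥ x) := by
  have hc : Continuous (toLin' B) := LinearMap.continuous_of_finiteDimensional _
  have h := (integrable_map_measure (μ := volume) (f := toLin' B) (g := g)
    hg.aestronglyMeasurable hc.aemeasurable).mp
  rw [Real.map_matrix_volume_pi_eq_smul_volume_pi hB] at h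
  exact h (hi.smul_measure ENNReal.ofReal_ne_top)

/-- The Gaussian `exp (-π xᵗ M x)` times the character `exp (-2πi ⟨y, x⟩)`. -/
def gaussianChar {n : ℕ} (M : Matrix (Fin n) (Fin n) ℝ) (y x : Fin n → ℝ) : ℂ :=
  Complex.exp (-Real.pi * (x ⬝ᵥ M *ᵥ x : ℝ) + (-2 * Real.pi * (y ⬝ᵥ x : ℝ)) * Complex.I)

theorem continuous_gaussianChar {n : ℕ} (M : Matrix (Fin n) (Fin n) ℝ) (y : Fin n → ℝ) :
    Continuous (gaussianChar M y) := by
  unfold gaussianChar dotProduct mulVec dotProduct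
  fun_prop

theorem norm_gaussianChar {n : ℕ} (M : Matrix (Fin n) (Fin n) ℝ) (y x : Fin n → ℝ) :
    ‖gaussianChar M y x‖ = Real.exp (-Real.pi * (x ⬝ᵥ M *ᵥ x)) := by
  rw [gaussianChar, Complex.norm_exp]
  simp

theorem gaussianChar_transpose_mul_self {n : ℕ} {B : Matrix (Fin n) (Fin n) ℝ} (hB : B.det ≠ 0)
    (y x : Fin n → ℝ) :
    gaussianChar (Bᵀ * B) y x = gaussianChar 1 ((B⁻¹)ᵀ *ᵥ y) (B *ᵥ x) := by
  have hu : IsUnit B.det := hB.isUnit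
  have h1 : x ⬝ᵥ (Bᵀ * B) *ᵥ x = (B *ᵥ x) ⬝ᵥ (1 : Matrix (Fin n) (Fin n) ℝ) *ᵥ (B *ᵥ x) := by
    rw [one_mulVec, ← mulVec_mulVec, dotProduct_mulVec, vecMul_transpose]
  have h2 : ((B⁻¹)ᵀ *ᵥ y) ⬝ᵥ (B *ᵥ x) = y ⬝ᵥ x := by
    rw [dotProduct_mulVec, mulVec_transpose, vecMul_vecMul, nonsing_inv_mul _ hu, vecMul_one]
  rw [gaussianChar, gaussianChar, h1, h2]

theorem gaussianChar_one {n : ℕ} (y x : Fin n → ℝ) :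
    gaussianChar 1 y x = Complex.exp (-(Real.pi : ℂ) * ∑ i, (x i : ℂ) ^ 2 +
      ∑ i, (-2 * Real.pi * y i * Complex.I) * (x i : ℂ)) := by
  rw [gaussianChar, one_mulVec]
  congr 2
  · simp [dotProduct, pow_two]
  · simp only [dotProduct, Complex.ofReal_sum, Finset.mul_sum, Finset.sum_mul, Complex.ofReal_mul]
    exact Finset.sum_congr rfl fun i _ => by ring

theorem integrable_gaussianChar {n : ℕ} {M : Matrix (Fin n) (Fin n) ℝ} (hM : M.PosDef)
    (y : Fin n → ℝ) : Integrable (gaussianChar M y) := by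
  obtain ⟨B, hB, rfl⟩ := exists_eq_transpose_mul_self hM
  have h1 : gaussianChar (Bᵀ * B) y = fun x => gaussianChar 1 ((B⁻¹)ᵀ *ᵥ y) (B *ᵥ x) :=
    funext (gaussianChar_transpose_mul_self hB y)
  rw [h1]
  refine integrable_comp_mulVec hB (continuous_gaussianChar _ _) ?_
  simp_rw [funext (gaussianChar_one _)]
  exact GaussianFourier.integrable_cexp_neg_mul_sum_add (by simpa using Real.pi_pos) _

theorem integral_gaussianChar {n : ℕ} {M : Matrix (Fin n) (Fin n) ℝ} (hM : M.PosDef) :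
    ∃ K : ℝ, 0 < K ∧ ∀ y, ∫ x, gaussianChar M y x =
      (K * Real.exp (-Real.pi * (y ⬝ᵥ M⁻¹ *ᵥ y)) : ℝ) := by
  obtain ⟨B, hB, rfl⟩ := exists_eq_transpose_mul_self hM
  refine ⟨|B.det⁻¹|, by positivity, fun y => ?_⟩
  simp_rw [gaussianChar_transpose_mul_self hB]
  rw [integral_comp_mulVec hB (continuous_gaussianChar _ _), Complex.ofReal_mul]
  congr 1
  simp_rw [gaussianChar_one]
  rw [GaussianFourier.integral_cexp_neg_mul_sum_add (by simpa using Real.pi_pos)]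
  have hpi : (Real.pi : ℂ) ≠ 0 := by exact_mod_cast Real.pi_ne_zero
  rw [div_self hpi, Complex.one_cpow, one_mul, Complex.ofReal_exp]
  congr 1
  have h : y ⬝ᵥ (Bᵀ * B)⁻¹ *ᵥ y = ∑ i, ((B⁻¹)ᵀ *ᵥ y) i ^ 2 := by
    rw [Matrix.mul_inv_rev, ← mulVec_mulVec, dotProduct_mulVec, ← transpose_nonsing_inv,
      ← mulVec_transpose]
    simp [dotProduct, pow_two]
  rw [h]
  push_cast
  rw [Finset.sum_div, Finset.mul_sum]
  refine Finset.sum_congr rfl fun i _ => ?_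
  have := Complex.I_sq
  field_simp
  rw [this]
  ring

/-- An integer vector, regarded as a real vector. -/
def realVec {n : ℕ} (z : Fin n → ℤ) : Fin n → ℝ := fun i => (z i : ℝ)

/-! ### The Gaussian periodized over `ℤⁿ`. -/

theorem summable_exp_neg_mul_sum_sq {n : ℕ} {a : ℝ} (ha : 0 < a) :
    Summable fun z : Fin n → ℤ => Real.exp (-a * ∑ i, (z i : ℝ) ^ 2) := by
  have h : ∀ z : Fin n → ℤ, ENNReal.ofReal (Real.exp (-a * ∑ i, (z i : ℝ) ^ 2)) =
      ∏ i, ENNReal.ofReal (Real.exp (-a * (z i : ℝ) ^ 2)) := fun z => by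
    rw [← ENNReal.ofReal_prod_of_nonneg (fun _ _ => (Real.exp_pos _).le), ← Real.exp_sum,
      ← Finset.mul_sum]
  suffices h' : ∑' z : Fin n → ℤ,
      ENNReal.ofReal (Real.exp (-a * ∑ i, (z i : ℝ) ^ 2)) ≠ ∞ from
    (ENNReal.summable_toReal h').congr fun z => ENNReal.toReal_ofReal (Real.exp_pos _).le
  simp_rw [h]
  rw [tsum_pi_prod (fun k : ℤ => ENNReal.ofReal (Real.exp (-a * (k : ℝ) ^ 2)))]
  exact ENNReal.pow_ne_top (tsum_exp_sq_ne_top _ ha)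

/-- From `|z|² ≤ 2|x + z|² + 2|x|²`. The damping factor in `x` makes the majorant independent of
`x`, as the Weierstrass test requires. -/
theorem exists_gaussian_shift_le {n : ℕ} {M : Matrix (Fin n) (Fin n) ℝ} (hM : M.PosDef) :
    ∃ a : ℝ, 0 < a ∧ ∀ (x : Fin n → ℝ) (z : Fin n → ℤ),
      Real.exp (-(2 * a) * ∑ i, x i ^ 2) *
        Real.exp (-Real.pi * ((x + realVec z) ⬝ᵥ M *ᵥ (x + realVec z))) ≤
        Real.exp (-a * ∑ i, (z i : ℝ) ^ 2) := by
  obtain ⟨c, hc, h⟩ := exists_le_quadratic hM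
  refine ⟨Real.pi * c / 2, by positivity, fun x z => ?_⟩
  rw [← Real.exp_add]
  apply Real.exp_le_exp.mpr
  have h1 := mul_le_mul_of_nonneg_left (h (x + realVec z)) Real.pi_pos.le
  have h2 : ∑ i, (z i : ℝ) ^ 2 ≤ 2 * ∑ i, (x + realVec z) i ^ 2 + 2 * ∑ i, x i ^ 2 := by
    rw [Finset.mul_sum, Finset.mul_sum, ← Finset.sum_add_distrib]
    refine Finset.sum_le_sum fun i _ => ?_
    simp only [Pi.add_apply, realVec]
    nlinarith [sq_nonneg ((z i : ℝ) + 2 * x i)]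
  have h3 := mul_le_mul_of_nonneg_left h2 (show 0 ≤ Real.pi * c / 2 by positivity)
  linarith

theorem summable_gaussian_shift {n : ℕ} {M : Matrix (Fin n) (Fin n) ℝ} (hM : M.PosDef)
    (x : Fin n → ℝ) : Summable fun z : Fin n → ℤ =>
      Real.exp (-Real.pi * ((x + realVec z) ⬝ᵥ M *ᵥ (x + realVec z))) := by
  obtain ⟨a, ha, h⟩ := exists_gaussian_shift_le hM
  have := Summable.of_nonneg_of_le (fun z => by positivity) (h x)
    (summable_exp_neg_mul_sum_sq ha)
  exact (summable_mul_left_iff (Real.exp_pos _).ne').mp this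

/-- The sum of the Gaussian `exp (-π vᵗ M v)` over the coset `x + ℤⁿ`. -/
def gaussianPeriodization {n : ℕ} (M : Matrix (Fin n) (Fin n) ℝ) (x : Fin n → ℝ) : ℂ :=
  ∑' z : Fin n → ℤ, gaussianChar M 0 (x + realVec z)

/-- The damped series converges uniformly on all of `ℝⁿ`; dividing by the continuous, nowhere zero
damping factor recovers the periodization. -/
theorem continuous_gaussianPeriodization {n : ℕ} {M : Matrix (Fin n) (Fin n) ℝ}
    (hM : M.PosDef) : Continuous (gaussianPeriodization M) := by
  obtain ⟨a, ha, h⟩ := exists_gaussian_shift_le hM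
  have h1 : Continuous fun x : Fin n → ℝ => ∑' z : Fin n → ℤ,
      ((Real.exp (-(2 * a) * ∑ i, x i ^ 2) : ℝ) : ℂ) * gaussianChar M 0 (x + realVec z) := by
    refine continuous_tsum (fun z => ?_) (summable_exp_neg_mul_sum_sq ha) (fun z x => ?_)
    · exact (by fun_prop : Continuous fun x : Fin n → ℝ =>
        ((Real.exp (-(2 * a) * ∑ i, x i ^ 2) : ℝ) : ℂ)).mul
        ((continuous_gaussianChar M 0).comp (by fun_prop))
    · rw [norm_mul, norm_gaussianChar, Complex.norm_real, Real.norm_of_nonneg (Real.exp_pos _).le]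
      exact h x z
  have h2 : gaussianPeriodization M = fun x =>
      ((Real.exp (2 * a * ∑ i, x i ^ 2) : ℝ) : ℂ) * ∑' z : Fin n → ℤ,
      ((Real.exp (-(2 * a) * ∑ i, x i ^ 2) : ℝ) : ℂ) * gaussianChar M 0 (x + realVec z) := by
    funext x
    rw [tsum_mul_left, ← mul_assoc, ← Complex.ofReal_mul, ← Real.exp_add]
    simp [gaussianPeriodization]
  rw [h2]
  exact (by fun_prop : Continuous fun x : Fin n → ℝ =>
    ((Real.exp (2 * a * ∑ i, x i ^ 2) : ℝ) : ℂ)).mul h1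

theorem gaussianPeriodization_add_realVec {n : ℕ} (M : Matrix (Fin n) (Fin n) ℝ)
    (x : Fin n → ℝ) (w : Fin n → ℤ) :
    gaussianPeriodization M (x + realVec w) = gaussianPeriodization M x := by
  unfold gaussianPeriodization
  rw [← (Equiv.addLeft w).tsum_eq (fun z => gaussianChar M 0 (x + realVec z))]
  refine tsum_congr fun z => ?_
  congr 1
  ext i
  simp [realVec, add_assoc]

/-- Reduction of a real vector modulo `ℤⁿ`. -/
def toTorus {n : ℕ} (x : Fin n → ℝ) : UnitAddTorus (Fin n) := fun i => (x i : UnitAddCircle)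

theorem isQuotientMap_toTorus {n : ℕ} : Topology.IsQuotientMap (toTorus (n := n)) :=
  (IsOpenQuotientMap.piMap (f := fun (_ : Fin n) (x : ℝ) => (x : UnitAddCircle))
    fun _ => QuotientAddGroup.isOpenQuotientMap_mk).isQuotientMap

theorem exists_eq_add_realVec_of_toTorus_eq {n : ℕ} {x y : Fin n → ℝ}
    (h : toTorus x = toTorus y) : ∃ w, y = x + realVec w := by
  have h1 : ∀ i, ∃ k : ℤ, y i = x i + k := fun i => by
    have := congrFun h i
    obtain ⟨k, hk⟩ := (QuotientAddGroup.eq_iff_sub_mem.trans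
      AddSubgroup.mem_zmultiples_iff).mp this.symm
    exact ⟨k, by simp at hk; linarith⟩
  choose w hw using h1
  exact ⟨w, funext hw⟩

theorem factorsThrough_toTorus {n : ℕ} {M : Matrix (Fin n) (Fin n) ℝ} :
    Function.FactorsThrough (gaussianPeriodization M) toTorus := fun x y h => by
  obtain ⟨w, rfl⟩ := exists_eq_add_realVec_of_toTorus_eq h
  exact (gaussianPeriodization_add_realVec M x w).symm

/-- The periodized Gaussian as a function on the torus. -/
def torusGaussian {n : ℕ} {M : Matrix (Fin n) (Fin n) ℝ} (hM : M.PosDef) :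
    C(UnitAddTorus (Fin n), ℂ) :=
  (isQuotientMap_toTorus (n := n)).lift (f := ⟨toTorus, isQuotientMap_toTorus.continuous⟩)
    ⟨gaussianPeriodization M, continuous_gaussianPeriodization hM⟩ factorsThrough_toTorus

theorem torusGaussian_toTorus {n : ℕ} {M : Matrix (Fin n) (Fin n) ℝ} (hM : M.PosDef)
    (x : Fin n → ℝ) : torusGaussian hM (toTorus x) = gaussianPeriodization M x :=
  DFunLike.congr_fun ((isQuotientMap_toTorus (n := n)).lift_comp
    (f := ⟨toTorus, isQuotientMap_toTorus.continuous⟩)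
    ⟨gaussianPeriodization M, continuous_gaussianPeriodization hM⟩ factorsThrough_toTorus) x

theorem mFourier_toTorus {n : ℕ} (y : Fin n → ℤ) (x : Fin n → ℝ) :
    UnitAddTorus.mFourier y (toTorus x) =
      Complex.exp (2 * Real.pi * (realVec y ⬝ᵥ x : ℝ) * Complex.I) := by
  simp only [UnitAddTorus.mFourier, ContinuousMap.coe_mk, toTorus, fourier_coe_apply]
  rw [← Complex.exp_sum]
  congr 1
  simp only [dotProduct, realVec, Complex.ofReal_sum, Finset.mul_sum, Finset.sum_mul]
  refine Finset.sum_congr rfl fun i _ => ?_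
  push_cast
  ring

/-- The half-open unit cube with lowest corner `z`. -/
def unitCube {n : ℕ} (z : Fin n → ℤ) : Set (Fin n → ℝ) :=
  {x | ∀ i, x i ∈ Set.Ioc (z i : ℝ) (z i + 1)}

theorem measurableSet_unitCube {n : ℕ} (z : Fin n → ℤ) : MeasurableSet (unitCube z) :=
  MeasurableSet.univ_pi' fun _ => measurableSet_Ioc

theorem mem_unitCube_iff {n : ℕ} {z : Fin n → ℤ} {x : Fin n → ℝ} :
    x ∈ unitCube z ↔ z = fun i => ⌈x i⌉ - 1 := by
  simp only [unitCube, Set.mem_ofPred_eq, Set.mem_Ioc, funext_iff]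
  refine forall_congr' fun i => ?_
  rw [eq_sub_iff_add_eq, eq_comm, Int.ceil_eq_iff]
  push_cast
  simp

theorem hasSum_integral_unitCube {n : ℕ} {E : Type*} [NormedAddCommGroup E] [NormedSpace ℝ E]
    {g : (Fin n → ℝ) → E} (hg : Integrable g) :
    HasSum (fun z : Fin n → ℤ => ∫ x in unitCube 0, g (x + realVec z)) (∫ x, g x) := by
  have hU : (⋃ z : Fin n → ℤ, unitCube z) = Set.univ :=
    Set.eq_univ_of_forall fun x => Set.mem_iUnion.mpr ⟨_, mem_unitCube_iff.mpr rfl⟩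
  have hd : Pairwise (Function.onFun Disjoint (unitCube (n := n))) := fun z w hzw =>
    Set.disjoint_left.mpr fun x hx hx' =>
      hzw ((mem_unitCube_iff.mp hx).trans (mem_unitCube_iff.mp hx').symm)
  have h := hasSum_integral_iUnion (fun z : Fin n → ℤ => measurableSet_unitCube z) hd
    (hg.integrableOn)
  rw [hU, setIntegral_univ] at h
  convert h using 2 with z
  have hmp := measurePreserving_add_right (volume : Measure (Fin n → ℝ)) (realVec z)
  rw [← hmp.setIntegral_preimage_emb (measurableEmbedding_addRight _) g]
  congr 2
  ext x
  simp [unitCube, realVec, add_comm (x _)]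

/-- Unfolding: the character of an integer frequency is `ℤⁿ`-periodic, so it can be moved inside the
sum over shifts, and the integrals over the translated unit cubes add up to the integral over `ℝⁿ`.
-/
theorem mFourierCoeff_torusGaussian {n : ℕ} {M : Matrix (Fin n) (Fin n) ℝ} (hM : M.PosDef)
    (y : Fin n → ℤ) :
    UnitAddTorus.mFourierCoeff (torusGaussian hM) y = ∫ x, gaussianChar M (realVec y) x := by
  have hg := integrable_gaussianChar hM (realVec y)
  have hz : ∀ z : Fin n → ℤ,
      Integrable (fun x => gaussianChar M (realVec y) (x + realVec z)) := fun z =>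
    hg.comp_add_right (realVec z)
  have h := hasSum_integral_of_summable_integral_norm (μ := volume.restrict (unitCube 0))
    (fun z => (hz z).restrict) (hasSum_integral_unitCube hg.norm).summable
  rw [(hasSum_integral_unitCube hg).unique h,
    UnitAddTorus.mFourierCoeff_eq_integral _ _ (realVec 0)]
  refine integral_congr_ae (Filter.Eventually.of_forall fun x => ?_)
  change UnitAddTorus.mFourier (-y) (toTorus x) • torusGaussian hM (toTorus x) = _
  rw [torusGaussian_toTorus, mFourier_toTorus, gaussianPeriodization, smul_eq_mul,
    ← tsum_mul_left]
  refine tsum_congr fun z => ?_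
  rw [gaussianChar, gaussianChar, ← Complex.exp_add]
  have h1 : realVec (-y) ⬝ᵥ x = - (realVec y ⬝ᵥ x) := by
    rw [← neg_dotProduct]
    congr 1
    ext i
    simp [realVec]
  have h2 : realVec y ⬝ᵥ realVec z = ((y ⬝ᵥ z : ℤ) : ℝ) := by
    simp [dotProduct, realVec]
  rw [h1, zero_dotProduct, dotProduct_add, h2, Complex.exp_eq_exp_iff_exists_int]
  -- The exponents differ by `2πi ⟨y, z⟩`, with `⟨y, z⟩` an integer.
  refine ⟨y ⬝ᵥ z, ?_⟩
  push_cast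
  ring

/-- Poisson summation for the Gaussian of a positive definite quadratic form. -/
theorem hasSum_gaussianPeriodization {n : ℕ} {M : Matrix (Fin n) (Fin n) ℝ} (hM : M.PosDef) :
    ∃ K : ℝ, 0 < K ∧ ∀ x, HasSum (fun y : Fin n → ℤ =>
      ((K * Real.exp (-Real.pi * (realVec y ⬝ᵥ M⁻¹ *ᵥ realVec y)) : ℝ) : ℂ) *
        Complex.exp (2 * Real.pi * (realVec y ⬝ᵥ x : ℝ) * Complex.I))
      (gaussianPeriodization M x) := by
  obtain ⟨K, hK, h⟩ := integral_gaussianChar hM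
  have hs : Summable (UnitAddTorus.mFourierCoeff (torusGaussian hM)) := by
    simp_rw [funext (mFourierCoeff_torusGaussian hM), h]
    rw [Complex.summable_ofReal]
    refine Summable.mul_left _ ?_
    simpa using summable_gaussian_shift hM.inv 0
  refine ⟨K, hK, fun x => ?_⟩
  have := UnitAddTorus.hasSum_mFourier_series_apply_of_summable hs (toTorus x)
  rw [torusGaussian_toTorus] at this
  convert this using 2 with y
  rw [mFourierCoeff_torusGaussian, h, smul_eq_mul, mFourier_toTorus]

/-- `K` is the zeroth Fourier coefficient; the shift only rotates the phases of the others, whose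
absolute values sum to at most `K ε`. As `gaussianWeight M` is defined through `M⁻¹`, the hypothesis
is about the dual Gaussian. -/
theorem abs_tsum_gaussian_shift_sub_le {n : ℕ} {M : Matrix (Fin n) (Fin n) ℝ} (hM : M.PosDef)
    {ε : ℝ} (hε : 0 ≤ ε) (h : ∑' y, gaussianWeight M y ≤ ENNReal.ofReal (1 + ε)) :
    ∃ K : ℝ, 0 < K ∧ ∀ x : Fin n → ℝ,
      |∑' z : Fin n → ℤ, Real.exp (-Real.pi * ((x + realVec z) ⬝ᵥ M *ᵥ (x + realVec z))) - K| ≤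
        K * ε := by
  obtain ⟨K, hK, hsum⟩ := hasSum_gaussianPeriodization hM
  refine ⟨K, hK, fun x => ?_⟩
  have hw : Summable fun y : Fin n → ℤ =>
      Real.exp (-Real.pi * (realVec y ⬝ᵥ M⁻¹ *ᵥ realVec y)) := by
    simpa using summable_gaussian_shift hM.inv 0
  have hw1 : ∑' y : Fin n → ℤ, Real.exp (-Real.pi * (realVec y ⬝ᵥ M⁻¹ *ᵥ realVec y)) ≤ 1 + ε := by
    rw [← ENNReal.ofReal_le_ofReal_iff (by positivity),
      ENNReal.ofReal_tsum_of_nonneg (fun _ => (Real.exp_pos _).le) hw]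
    exact h
  have h0 : gaussianPeriodization M x = ((∑' z : Fin n → ℤ,
      Real.exp (-Real.pi * ((x + realVec z) ⬝ᵥ M *ᵥ (x + realVec z))) : ℝ) : ℂ) := by
    rw [gaussianPeriodization, Complex.ofReal_tsum]
    simp [gaussianChar]
  set w : (Fin n → ℤ) → ℝ := fun y =>
    Real.exp (-Real.pi * (realVec y ⬝ᵥ M⁻¹ *ᵥ realVec y)) with hwdef
  set t : (Fin n → ℤ) → ℂ := fun y => ((K * w y : ℝ) : ℂ) *
    Complex.exp (2 * Real.pi * (realVec y ⬝ᵥ x : ℝ) * Complex.I) with htdef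
  have ht : HasSum t (gaussianPeriodization M x) := hsum x
  have hr0 : realVec (0 : Fin n → ℤ) = 0 := by ext; simp [realVec]
  have hw0 : w 0 = 1 := by simp [hwdef, hr0]
  have ht0 : t 0 = K := by simp [htdef, hw0, hr0]
  have htn : ∀ y, ‖t y‖ = K * w y := fun y => by
    have : 2 * (Real.pi : ℂ) * (realVec y ⬝ᵥ x : ℝ) * Complex.I =
        ((2 * Real.pi * (realVec y ⬝ᵥ x) : ℝ) : ℂ) * Complex.I := by push_cast; ring
    rw [htdef, norm_mul, this, Complex.norm_exp_ofReal_mul_I, Complex.norm_real,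
      Real.norm_of_nonneg (mul_nonneg hK.le (Real.exp_pos _).le), mul_one]
  rw [← Real.norm_eq_abs, ← Complex.norm_real, Complex.ofReal_sub, ← h0, ← ht.tsum_eq,
    ht.summable.tsum_eq_add_tsum_ite 0,
    ht0, add_sub_cancel_left]
  have hwite := hw.tsum_eq_add_tsum_ite 0
  rw [← hwdef, hw0] at hwite
  refine (tsum_of_norm_bounded (g := fun y => K * if y = 0 then 0 else w y)
    (a := K * ∑' y, if y = 0 then 0 else w y) ?_ fun y => ?_).trans ?_
  · refine HasSum.mul_left _ (Summable.hasSum ?_)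
    exact Summable.of_nonneg_of_le (fun y => by split_ifs; exacts [le_rfl, (Real.exp_pos _).le])
      (fun y => by split_ifs; exacts [(Real.exp_pos _).le, le_rfl]) hw
  · split_ifs
    · simp
    · exact (htn y).le
  · refine mul_le_mul_of_nonneg_left ?_ hK.le
    linarith

/-- Poisson summation in the form of smoothing: the Gaussian mass of the coset `x + ℤⁿ` hardly
depends on `x` when the dual Gaussian sum is close to `1`. -/
theorem exists_tsum_gaussian_shift_bounds {n : ℕ} {M : Matrix (Fin n) (Fin n) ℝ} (hM : M.PosDef)
    {ε : ℝ} (hε : 0 ≤ ε) (h : ∑' y, gaussianWeight M y ≤ ENNReal.ofReal (1 + ε)) :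
    ∃ K : ℝ, 0 < K ∧ ∀ x : Fin n → ℝ,
      ENNReal.ofReal (K * (1 - ε)) ≤ ∑' z : Fin n → ℤ, ENNReal.ofReal
        (Real.exp (-Real.pi * ((x + realVec z) ⬝ᵥ M *ᵥ (x + realVec z)))) ∧
      ∑' z : Fin n → ℤ, ENNReal.ofReal
        (Real.exp (-Real.pi * ((x + realVec z) ⬝ᵥ M *ᵥ (x + realVec z)))) ≤
        ENNReal.ofReal (K * (1 + ε)) := by
  obtain ⟨K, hK, hb⟩ := abs_tsum_gaussian_shift_sub_le hM hε h
  refine ⟨K, hK, fun x => ?_⟩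
  rw [← ENNReal.ofReal_tsum_of_nonneg (fun _ => (Real.exp_pos _).le) (summable_gaussian_shift hM x)]
  have := abs_le.mp (hb x)
  constructor <;> exact ENNReal.ofReal_le_ofReal (by linarith)

/-! ### Quadratic form inequalities and the covariance of the fibre. -/

theorem dotProduct_inv_mulVec_le {n : ℕ} {C : Matrix (Fin n) (Fin n) ℝ} (hC : C.PosDef) {k : ℝ}
    (hk : 0 < k) (h : ∀ v, k * (v ⬝ᵥ v) ≤ v ⬝ᵥ C *ᵥ v) (v : Fin n → ℝ) :
    v ⬝ᵥ C⁻¹ *ᵥ v ≤ v ⬝ᵥ v / k := by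
  set u := C⁻¹ *ᵥ v with hu
  have hCu : C *ᵥ u = v := by
    rw [hu, mulVec_mulVec, mul_nonsing_inv _ hC.det_pos.ne'.isUnit, one_mulVec]
  have h1 := h u
  rw [hCu] at h1
  have h2 : 0 ≤ (v - k • u) ⬝ᵥ (v - k • u) := by
    simpa using dotProduct_star_self_nonneg (v - k • u)
  simp only [sub_dotProduct, dotProduct_sub, smul_dotProduct, dotProduct_smul, smul_eq_mul] at h2
  rw [le_div_iff₀ hk]
  rw [dotProduct_comm u v] at h1 h2
  nlinarith

/-- Expand the nonnegative value of the form `M` at `M⁻¹ y - k y`. -/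
theorem le_dotProduct_inv_mulVec {n : ℕ} {M : Matrix (Fin n) (Fin n) ℝ} (hM : M.PosDef) {k : ℝ}
    (hk : 0 < k) (h : ∀ v, v ⬝ᵥ M *ᵥ v ≤ v ⬝ᵥ v / k) (y : Fin n → ℝ) :
    k * (y ⬝ᵥ y) ≤ y ⬝ᵥ M⁻¹ *ᵥ y := by
  set u := M⁻¹ *ᵥ y with hu
  have hMu : M *ᵥ u = y := by
    rw [hu, mulVec_mulVec, mul_nonsing_inv _ hM.det_pos.ne'.isUnit, one_mulVec]
  have hsymm : ∀ a b, a ⬝ᵥ M *ᵥ b = b ⬝ᵥ M *ᵥ a := fun a b => by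
    have hT : Mᵀ = M := by simpa using hM.isHermitian.eq
    rw [dotProduct_mulVec, ← mulVec_transpose, hT, dotProduct_comm]
  have h2 : 0 ≤ (u - k • y) ⬝ᵥ M *ᵥ (u - k • y) := by
    simpa using hM.posSemidef.dotProduct_mulVec_nonneg (u - k • y)
  simp only [mulVec_sub, mulVec_smul, sub_dotProduct, dotProduct_sub, smul_dotProduct,
    dotProduct_smul, smul_eq_mul] at h2
  have h4 := hsymm u y
  rw [hMu] at h2 h4
  rw [h4, dotProduct_comm u y] at h2
  have h3 := mul_le_mul_of_nonneg_left (h y) (mul_pos hk hk).le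
  have h5 : k * k * (y ⬝ᵥ y / k) = k * (y ⬝ᵥ y) := by field_simp
  linarith

section Perturbation

variable {m n : ℕ}

/-- With `p = Tᵗ x`, Cauchy–Schwarz gives `|p|⁴ = ⟨x, T p⟩² ≤ |x|² |T p|² ≤ σ² |x|² |p|²`. -/
theorem dotProduct_transpose_mulVec_self_le {T : Matrix (Fin m) (Fin n) ℝ} {σ : ℝ}
    (hT : ∀ v, (T *ᵥ v) ⬝ᵥ (T *ᵥ v) ≤ σ ^ 2 * (v ⬝ᵥ v)) (x : Fin m → ℝ) :
    (Tᵀ *ᵥ x) ⬝ᵥ (Tᵀ *ᵥ x) ≤ σ ^ 2 * (x ⬝ᵥ x) := by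
  set p := Tᵀ *ᵥ x with hp
  have h1 : p ⬝ᵥ p = x ⬝ᵥ T *ᵥ p := by
    rw [dotProduct_mulVec x T, ← mulVec_transpose]
  have hpp : 0 ≤ p ⬝ᵥ p := by simpa using dotProduct_star_self_nonneg p
  have hxx : 0 ≤ x ⬝ᵥ x := by simpa using dotProduct_star_self_nonneg x
  have h2 : (x ⬝ᵥ T *ᵥ p) ^ 2 ≤ (x ⬝ᵥ x) * ((T *ᵥ p) ⬝ᵥ (T *ᵥ p)) := by
    have := Finset.sum_mul_sq_le_sq_mul_sq Finset.univ x (T *ᵥ p)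
    simpa [dotProduct, pow_two] using this
  rw [← h1] at h2
  have h3 := mul_le_mul_of_nonneg_left (hT p) hxx
  rcases hpp.eq_or_lt with h0 | h0
  · rw [← h0]
    positivity
  · nlinarith

theorem dotProduct_perturbation_mulVec (T : Matrix (Fin m) (Fin n) ℝ) (r s : ℝ) (x : Fin m → ℝ) :
    x ⬝ᵥ (s ^ 2 • (1 : Matrix (Fin m) (Fin m) ℝ) - r ^ 2 • (T * Tᵀ)) *ᵥ x =
      s ^ 2 * (x ⬝ᵥ x) - r ^ 2 * ((Tᵀ *ᵥ x) ⬝ᵥ (Tᵀ *ᵥ x)) := by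
  rw [sub_mulVec, smul_mulVec, smul_mulVec, one_mulVec, dotProduct_sub, dotProduct_smul,
    dotProduct_smul, ← mulVec_mulVec, dotProduct_mulVec x T, ← mulVec_transpose]
  simp

theorem le_dotProduct_perturbation_mulVec {T : Matrix (Fin m) (Fin n) ℝ} {r s η σ : ℝ}
    (hT : ∀ v, (T *ᵥ v) ⬝ᵥ (T *ᵥ v) ≤ σ ^ 2 * (v ⬝ᵥ v))
    (hs : (r ^ 2 + η ^ 2) * (σ ^ 2 + 1) ≤ s ^ 2) (x : Fin m → ℝ) :
    (r ^ 2 + η ^ 2 * (σ ^ 2 + 1)) * (x ⬝ᵥ x) ≤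
      x ⬝ᵥ (s ^ 2 • (1 : Matrix (Fin m) (Fin m) ℝ) - r ^ 2 • (T * Tᵀ)) *ᵥ x := by
  rw [dotProduct_perturbation_mulVec]
  have h1 := mul_le_mul_of_nonneg_left (dotProduct_transpose_mulVec_self_le hT x) (sq_nonneg r)
  have hxx : 0 ≤ x ⬝ᵥ x := by simpa using dotProduct_star_self_nonneg x
  have h2 := mul_le_mul_of_nonneg_right hs hxx
  nlinarith

theorem posDef_perturbation {T : Matrix (Fin m) (Fin n) ℝ} {r s η σ : ℝ} (hr : 0 < r)
    (hT : ∀ v, (T *ᵥ v) ⬝ᵥ (T *ᵥ v) ≤ σ ^ 2 * (v ⬝ᵥ v))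
    (hs : (r ^ 2 + η ^ 2) * (σ ^ 2 + 1) ≤ s ^ 2) :
    (s ^ 2 • (1 : Matrix (Fin m) (Fin m) ℝ) - r ^ 2 • (T * Tᵀ)).PosDef := by
  refine PosDef.of_dotProduct_mulVec_pos ?_ fun x hx => ?_
  · rw [IsHermitian, conjTranspose_eq_transpose_of_trivial]
    simp
  · have h := le_dotProduct_perturbation_mulVec hT hs x
    have hxx : 0 < x ⬝ᵥ x := by simpa using dotProduct_star_self_pos_iff.mpr hx
    simp only [star_trivial]
    exact lt_of_lt_of_le (by positivity) h

/-- The inverse covariance, on `ℤⁿ`, of the preimage of a fixed point under `(p, v) ↦ p + T v`. -/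
def fiberPrecision (T : Matrix (Fin m) (Fin n) ℝ) (C : Matrix (Fin m) (Fin m) ℝ) (r : ℝ) :
    Matrix (Fin n) (Fin n) ℝ :=
  (r ^ 2)⁻¹ • 1 + Tᵀ * C⁻¹ * T

theorem dotProduct_fiberPrecision_mulVec (T : Matrix (Fin m) (Fin n) ℝ)
    (C : Matrix (Fin m) (Fin m) ℝ) (r : ℝ) (v : Fin n → ℝ) :
    v ⬝ᵥ fiberPrecision T C r *ᵥ v =
      (r ^ 2)⁻¹ * (v ⬝ᵥ v) + (T *ᵥ v) ⬝ᵥ C⁻¹ *ᵥ (T *ᵥ v) := by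
  rw [fiberPrecision, add_mulVec, smul_mulVec, one_mulVec, dotProduct_add, dotProduct_smul,
    Matrix.mul_assoc, ← mulVec_mulVec, dotProduct_mulVec v Tᵀ, vecMul_transpose, mulVec_mulVec]
  simp

theorem posDef_fiberPrecision (T : Matrix (Fin m) (Fin n) ℝ) {C : Matrix (Fin m) (Fin m) ℝ}
    (hC : C.PosDef) {r : ℝ} (hr : 0 < r) : (fiberPrecision T C r).PosDef := by
  refine (Matrix.PosDef.one.smul (by positivity : 0 < (r ^ 2)⁻¹)).add_posSemidef ?_
  simpa using hC.inv.posSemidef.conjTranspose_mul_mul_same T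

/-- Each of the two summands of the precision matrix is at most `η⁻² I`: the first because `η ≤ r`,
the second because `Σ_p ≥ r² + η² (σ² + 1)`. Their sum is at most `2 η⁻² I`, whence the factor `1/2`
after inversion. -/
theorem le_dotProduct_inv_fiberPrecision {T : Matrix (Fin m) (Fin n) ℝ} {r s η σ : ℝ}
    (hr : 0 < r) (hη : 0 ≤ η) (hηr : η ≤ r)
    (hT : ∀ v, (T *ᵥ v) ⬝ᵥ (T *ᵥ v) ≤ σ ^ 2 * (v ⬝ᵥ v))
    (hs : (r ^ 2 + η ^ 2) * (σ ^ 2 + 1) ≤ s ^ 2) (y : Fin n → ℝ) :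
    η ^ 2 / 2 * (y ⬝ᵥ y) ≤
      y ⬝ᵥ (fiberPrecision T (s ^ 2 • 1 - r ^ 2 • (T * Tᵀ)) r)⁻¹ *ᵥ y := by
  have hC := posDef_perturbation hr hT hs
  have hM := posDef_fiberPrecision T hC hr
  rcases hη.eq_or_lt with rfl | hη
  -- `η = 0` does occur: for `n = 0` every positive `t` is admissible in the infimum.
  · simpa using hM.inv.posSemidef.dotProduct_mulVec_nonneg y
  refine le_dotProduct_inv_mulVec hM (by positivity) (fun v => ?_) y
  have hvv : 0 ≤ v ⬝ᵥ v := by simpa using dotProduct_star_self_nonneg v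
  have hk : 0 < r ^ 2 + η ^ 2 * (σ ^ 2 + 1) := by positivity
  have h1 := dotProduct_inv_mulVec_le hC hk (le_dotProduct_perturbation_mulVec hT hs) (T *ᵥ v)
  have h2 : (T *ᵥ v) ⬝ᵥ (T *ᵥ v) / (r ^ 2 + η ^ 2 * (σ ^ 2 + 1)) ≤ v ⬝ᵥ v / η ^ 2 := by
    rw [div_le_div_iff₀ hk (by positivity)]
    have := mul_le_mul_of_nonneg_right (hT v) (sq_nonneg η)
    nlinarith [mul_nonneg hvv (sq_nonneg η), mul_nonneg hvv (sq_nonneg r)]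
  have h3 : (r ^ 2)⁻¹ * (v ⬝ᵥ v) ≤ v ⬝ᵥ v / η ^ 2 := by
    rw [div_eq_inv_mul]
    gcongr
  rw [dotProduct_fiberPrecision_mulVec]
  calc _ ≤ v ⬝ᵥ v / η ^ 2 + v ⬝ᵥ v / η ^ 2 := add_le_add h3 (h1.trans h2)
    _ = _ := by field_simp; ring

/-- With `w = v - (r²/s²) Tᵗ x` one has `x - T v = s⁻² Σ_p x - T w`. Applying `Σ_p⁻¹` leaves only
`s⁻² x` and `Σ_p⁻¹ T w`, and the cross terms cancel; no formula for `Σ_p⁻¹` is needed. -/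
theorem gaussian_fiber_complete_square {T : Matrix (Fin m) (Fin n) ℝ} {r s : ℝ} (hr : 0 < r)
    (hs : 0 < s) (hC : (s ^ 2 • (1 : Matrix (Fin m) (Fin m) ℝ) - r ^ 2 • (T * Tᵀ)).PosDef)
    (x : Fin m → ℝ) (v : Fin n → ℝ) :
    (r ^ 2)⁻¹ * (v ⬝ᵥ v) +
        (x - T *ᵥ v) ⬝ᵥ (s ^ 2 • 1 - r ^ 2 • (T * Tᵀ))⁻¹ *ᵥ (x - T *ᵥ v) =
      (s ^ 2)⁻¹ * (x ⬝ᵥ x) + (-(r ^ 2 / s ^ 2) • (Tᵀ *ᵥ x) + v) ⬝ᵥ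
        fiberPrecision T (s ^ 2 • 1 - r ^ 2 • (T * Tᵀ)) r *ᵥ
          (-(r ^ 2 / s ^ 2) • (Tᵀ *ᵥ x) + v) := by
  have hqx := dotProduct_perturbation_mulVec T r s x
  rw [dotProduct_fiberPrecision_mulVec]
  set p := Tᵀ *ᵥ x with hp
  set w := -(r ^ 2 / s ^ 2) • p + v with hw
  have hv : v = w + (r ^ 2 / s ^ 2) • p := by rw [hw]; module
  have hCx : (s ^ 2 • (1 : Matrix (Fin m) (Fin m) ℝ) - r ^ 2 • (T * Tᵀ)) *ᵥ x =
      s ^ 2 • x - r ^ 2 • T *ᵥ p := by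
    rw [sub_mulVec, smul_mulVec, smul_mulVec, one_mulVec, ← mulVec_mulVec]
  set C := s ^ 2 • (1 : Matrix (Fin m) (Fin m) ℝ) - r ^ 2 • (T * Tᵀ) with hCdef
  set u := C⁻¹ *ᵥ (T *ᵥ w) with hu
  have hdet := hC.det_pos.ne'.isUnit
  have hCu : C *ᵥ u = T *ᵥ w := by
    rw [hu, mulVec_mulVec, mul_nonsing_inv _ hdet, one_mulVec]
  have hxT : x - T *ᵥ v = (s ^ 2)⁻¹ • C *ᵥ x - T *ᵥ w := by
    rw [hv, hCx, mulVec_add, mulVec_smul, smul_sub, smul_smul, smul_smul,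
      inv_mul_cancel₀ (by positivity), one_smul, div_eq_inv_mul]
    abel
  have hinv : C⁻¹ *ᵥ (x - T *ᵥ v) = (s ^ 2)⁻¹ • x - u := by
    rw [hxT, mulVec_sub, mulVec_smul, mulVec_mulVec, nonsing_inv_mul _ hdet, one_mulVec]
  have hsymm : (C *ᵥ x) ⬝ᵥ u = x ⬝ᵥ T *ᵥ w := by
    have hT : Cᵀ = C := by simpa using hC.isHermitian.eq
    rw [← hCu, dotProduct_mulVec x, ← mulVec_transpose, hT]
  have hpw : x ⬝ᵥ T *ᵥ w = p ⬝ᵥ w := by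
    rw [dotProduct_mulVec x T, ← mulVec_transpose]
  rw [hinv, hxT, hv]
  simp only [add_dotProduct, dotProduct_add, sub_dotProduct, dotProduct_sub, smul_dotProduct,
    dotProduct_smul, smul_eq_mul]
  rw [hsymm, dotProduct_comm (C *ᵥ x) x, hqx, dotProduct_comm (T *ᵥ w) x, hpw,
    dotProduct_comm w p]
  field_simp
  ring

end Perturbation

theorem inv_sq_smul_one {n : ℕ} {r : ℝ} (hr : r ≠ 0) :
    (r ^ 2 • (1 : Matrix (Fin n) (Fin n) ℝ))⁻¹ = (r ^ 2)⁻¹ • 1 := by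
  refine inv_eq_right_inv ?_
  rw [smul_mul_smul_comm, mul_inv_cancel₀ (by positivity), one_smul, Matrix.one_mul]

/-! ### Gaussian sums over `ℤⁿ` -/

theorem tsum_exp_neg_mul_sum_sq (n : ℕ) (a : ℝ) :
    ∑' z : Fin n → ℤ, ENNReal.ofReal (Real.exp (-a * (realVec z ⬝ᵥ realVec z))) =
      (∑' k : ℤ, ENNReal.ofReal (Real.exp (-a * (k : ℝ) ^ 2))) ^ n := by
  rw [← tsum_pi_prod (fun k : ℤ => ENNReal.ofReal (Real.exp (-a * (k : ℝ) ^ 2)))]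
  refine tsum_congr fun z => ?_
  rw [← ENNReal.ofReal_prod_of_nonneg (fun _ _ => (Real.exp_pos _).le), ← Real.exp_sum,
    ← Finset.mul_sum]
  simp only [dotProduct, realVec, pow_two]

theorem tsum_int_exp_neg_mul_sq_le {a : ℝ} (ha : Real.exp (-a) ≤ 3 / 4) :
    ∑' k : ℤ, ENNReal.ofReal (Real.exp (-a * (k : ℝ) ^ 2)) ≤
      ENNReal.ofReal (1 + 8 * Real.exp (-a)) := by
  set b := Real.exp (-a) with hb
  have hb0 : 0 < b := Real.exp_pos _
  have hg := hasSum_geometric_of_lt_one hb0.le (by linarith : b < 1)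
  have hs : HasSum (fun k : ℤ => b ^ k.natAbs) ((1 - b)⁻¹ + b * (1 - b)⁻¹) := by
    refine HasSum.of_nat_of_neg_add_one (by simpa using hg) ?_
    refine (hg.mul_left b).congr_fun fun k => ?_
    rw [← pow_succ', show (-((k : ℤ) + 1)).natAbs = k + 1 by omega]
  calc _ ≤ ∑' k : ℤ, ENNReal.ofReal (b ^ k.natAbs) := by
        refine ENNReal.tsum_le_tsum fun k => ENNReal.ofReal_le_ofReal ?_
        have h1 : Real.exp (-a * (k : ℝ) ^ 2) = b ^ (k.natAbs ^ 2) := by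
          rw [hb, ← Real.exp_nat_mul]
          congr 1
          push_cast
          rw [Nat.cast_natAbs, Int.cast_abs, sq_abs]
          ring
        rw [h1]
        exact pow_le_pow_of_le_one hb0.le (by linarith) (Nat.le_self_pow two_ne_zero _)
    _ = ENNReal.ofReal ((1 - b)⁻¹ + b * (1 - b)⁻¹) := by
        rw [← ENNReal.ofReal_tsum_of_nonneg (fun _ => by positivity) hs.summable, hs.tsum_eq]
    _ ≤ _ := by
        refine ENNReal.ofReal_le_ofReal ?_
        have h1 : 0 < 1 - b := by linarith
        rw [← one_add_mul, ← div_eq_mul_inv, div_le_iff₀ h1]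
        -- `(1 + b) / (1 - b) ≤ 1 + 8 b` amounts to `8 b² ≤ 6 b`, which is where `3 / 4` comes from.
        nlinarith

theorem tsum_exp_neg_mul_sum_sq_le {n : ℕ} {a τ : ℝ} (ha : Real.exp (-a) ≤ 3 / 4)
    (hn : 8 * (n * Real.exp (-a)) ≤ τ) (hτ : τ ≤ 1) :
    ∑' z : Fin n → ℤ, ENNReal.ofReal (Real.exp (-a * (realVec z ⬝ᵥ realVec z))) ≤
      ENNReal.ofReal (1 + 2 * τ) := by
  rw [tsum_exp_neg_mul_sum_sq]
  refine (pow_le_pow_left' (tsum_int_exp_neg_mul_sq_le ha) n).trans ?_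
  rw [← ENNReal.ofReal_pow (by positivity)]
  refine ENNReal.ofReal_le_ofReal ?_
  have hτ0 : 0 ≤ τ := le_trans (by positivity) hn
  calc (1 + 8 * Real.exp (-a)) ^ n ≤ Real.exp (8 * Real.exp (-a)) ^ n := by
        gcongr
        rw [add_comm]
        exact Real.add_one_le_exp _
    _ = Real.exp (8 * (n * Real.exp (-a))) := by
        rw [← Real.exp_nat_mul]
        congr 1
        ring
    _ ≤ Real.exp τ := Real.exp_le_exp.mpr hn
    _ ≤ _ := by
        have h1 := Real.abs_exp_sub_one_le (x := τ) (by rwa [abs_of_nonneg hτ0])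
        rw [abs_of_nonneg hτ0] at h1
        linarith [le_abs_self (Real.exp τ - 1)]

theorem one_add_two_mul_exp_le_tsum (a : ℝ) :
    ENNReal.ofReal (1 + 2 * Real.exp (-a)) ≤
      ∑' k : ℤ, ENNReal.ofReal (Real.exp (-a * (k : ℝ) ^ 2)) := by
  refine le_trans (le_of_eq ?_) (ENNReal.sum_le_tsum ({0, 1, -1} : Finset ℤ))
  rw [← ENNReal.ofReal_sum_of_nonneg (fun _ _ => (Real.exp_pos _).le)]
  congr 1
  rw [Finset.sum_insert (by decide), Finset.sum_insert (by decide), Finset.sum_singleton]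
  simp
  ring

/-- Shrinking the parameter by `√2` costs a square root in the smoothing error. -/
theorem tsum_exp_half_le {n N : ℕ} (hn : n ≤ N) {a ε τ : ℝ} (hε1 : ε < 1) (hτ0 : 0 ≤ τ)
    (h : ∑' z : Fin n → ℤ, ENNReal.ofReal (Real.exp (-a * (realVec z ⬝ᵥ realVec z))) ≤
      ENNReal.ofReal (1 + ε)) (hτ : N * ε ≤ τ ^ 2) (hτ1 : 8 * τ ≤ 1) :
    ∑' z : Fin n → ℤ, ENNReal.ofReal (Real.exp (-(a / 2) * (realVec z ⬝ᵥ realVec z))) ≤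
      ENNReal.ofReal (1 + 16 * τ) := by
  rcases Nat.eq_zero_or_pos n with rfl | hn0
  · rw [tsum_exp_neg_mul_sum_sq, pow_zero, ← ENNReal.ofReal_one]
    exact ENNReal.ofReal_le_ofReal (by linarith)
  set b := Real.exp (-(a / 2)) with hb
  have hb0 : 0 < b := Real.exp_pos _
  have hb2 : Real.exp (-a) = b ^ 2 := by
    rw [hb, ← Real.exp_nat_mul]
    congr 1
    push_cast
    ring
  rw [tsum_exp_neg_mul_sum_sq] at h
  have h1 := (pow_le_pow_left' (one_add_two_mul_exp_le_tsum a) n).trans h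
  rw [← ENNReal.ofReal_pow (by positivity), hb2] at h1
  have h2 : 0 < 1 + ε := by
    by_contra h0
    rw [ENNReal.ofReal_of_nonpos (not_lt.mp h0), nonpos_iff_eq_zero, ENNReal.ofReal_eq_zero] at h1
    exact absurd h1 (not_le.mpr (by positivity))
  rw [ENNReal.ofReal_le_ofReal_iff h2.le] at h1
  -- Bernoulli turns the hypothesis into `2 n b² ≤ ε`. Hence `(n b)² ≤ n ε / 2 ≤ τ²`, and `b² ≤ 1/2`
  -- puts `b` below the threshold `3 / 4`.
  have h3 := (one_add_mul_le_pow (a := 2 * b ^ 2) (by nlinarith) n).trans h1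
  have hn1 : (1 : ℝ) ≤ n := by exact_mod_cast hn0
  have hnN : (n : ℝ) ≤ N := by exact_mod_cast hn
  have hε0 : 0 ≤ ε := by
    have : 0 ≤ (n : ℝ) * (2 * b ^ 2) := by positivity
    linarith
  have h4 : b ^ 2 ≤ 1 / 2 := by nlinarith [sq_nonneg b]
  have h5 : n * b ≤ τ := by
    refine abs_le_of_sq_le_sq' ?_ hτ0 |>.2
    have h6 : (n : ℝ) * ε ≤ N * ε := by gcongr
    nlinarith [sq_nonneg b]
  rw [show 16 * τ = 2 * (8 * τ) by ring]
  exact tsum_exp_neg_mul_sum_sq_le (by rw [← hb]; nlinarith) (by rw [← hb]; linarith) hτ1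

/-! ### The smoothing parameter -/

theorem gaussianSum_antitone {m : ℕ} (S : Set (EuclideanSpace ℝ (Fin m))) {t₁ t₂ : ℝ}
    (h0 : 0 ≤ t₁) (h : t₁ ≤ t₂) : gaussianSum t₂ S ≤ gaussianSum t₁ S := by
  refine ENNReal.tsum_le_tsum fun y => ENNReal.ofReal_le_ofReal (Real.exp_le_exp.mpr ?_)
  have h1 : ‖t₁ • (y : EuclideanSpace ℝ (Fin m))‖ ≤ ‖t₂ • (y : EuclideanSpace ℝ (Fin m))‖ := by
    rw [norm_smul, norm_smul, Real.norm_of_nonneg h0, Real.norm_of_nonneg (h0.trans h)]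
    gcongr
  have := mul_le_mul_of_nonneg_left (pow_le_pow_left₀ (norm_nonneg _) h1 2) Real.pi_pos.le
  linarith

/-- The bound holds for every `t > r` by monotonicity and passes to `t = r` on each finite partial
sum, which is continuous in `t`. -/
theorem gaussianSum_le_of_sInf_le {m : ℕ} {S : Set (EuclideanSpace ℝ (Fin m))} {B : ℝ≥0∞}
    (hne : {t : ℝ | 0 < t ∧ gaussianSum t S ≤ B}.Nonempty) {r : ℝ}
    (h : sInf {t : ℝ | 0 < t ∧ gaussianSum t S ≤ B} ≤ r) : gaussianSum r S ≤ B := by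
  have hlt : ∀ t, r < t → gaussianSum t S ≤ B := fun t ht => by
    obtain ⟨t₀, ⟨h0, h1⟩, h2⟩ := exists_lt_of_csInf_lt hne (h.trans_lt ht)
    exact (gaussianSum_antitone S h0.le h2.le).trans h1
  rw [gaussianSum, ENNReal.tsum_eq_iSup_sum]
  refine iSup_le fun F => ?_
  have hc : Continuous fun t : ℝ => ∑ y ∈ F,
      ENNReal.ofReal (Real.exp (-Real.pi * ‖t • ((y : S) : EuclideanSpace ℝ (Fin m))‖ ^ 2)) :=
    continuous_finsetSum _ fun y _ => ENNReal.continuous_ofReal.comp (by fun_prop)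
  refine le_of_tendsto ((hc.tendsto r).mono_left (nhdsWithin_le_nhds (s := Set.Ioi r))) ?_
  filter_upwards [self_mem_nhdsWithin] with t ht
  exact (ENNReal.sum_le_tsum F).trans (hlt t ht)

/-! ### The lattice `L(Q)`, its dual and its smoothing parameter. -/

section Lattice

variable {n q : ℕ} [NeZero q] {P Q : Matrix (Fin n) (Fin n) ℤ}

/-- The integer matrix `Q`, regarded as a real matrix. -/
abbrev realMatrix {m n : ℕ} (T : Matrix (Fin m) (Fin n) ℤ) : Matrix (Fin m) (Fin n) ℝ :=
  T.map (Int.cast : ℤ → ℝ)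

theorem realMatrix_mulVec_realVec {m n : ℕ} (T : Matrix (Fin m) (Fin n) ℤ) (v : Fin n → ℤ) :
    realMatrix T *ᵥ realVec v = realVec (T *ᵥ v) := by
  ext i
  simp [realVec, mulVec, dotProduct]

theorem det_realMatrix_ne_zero (h : P * Q = (q : ℤ) • 1) : (realMatrix Q).det ≠ 0 := by
  have h1 : P.det * Q.det = (q : ℤ) ^ n := by
    rw [← det_mul, h, det_smul, det_one, mul_one, Fintype.card_fin]
  have h2 : Q.det ≠ 0 := fun h0 => by
    rw [h0, mul_zero] at h1
    exact pow_ne_zero n (by exact_mod_cast NeZero.ne q) h1.symm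
  have h3 : (realMatrix Q).det = ((Q.det : ℤ) : ℝ) := (Int.cast_det Q).symm
  rw [h3]
  exact_mod_cast h2

theorem mulVec_injective_of_mul_eq (h : P * Q = (q : ℤ) • 1) : Function.Injective (Q.mulVec) := by
  intro v w hvw
  have := congrArg (P *ᵥ ·) hvw
  simp only [mulVec_mulVec, h, smul_mulVec, one_mulVec] at this
  exact smul_right_injective _ (by exact_mod_cast NeZero.ne q : (q : ℤ) ≠ 0) this

theorem mul_eq_smul_one_comm (h : P * Q = (q : ℤ) • 1) : Q * P = (q : ℤ) • 1 := by
  have h1 : Q * (P * Q) = (Q * P) * Q := (Matrix.mul_assoc _ _ _).symm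
  rw [h] at h1
  have hQ : Q.det ≠ 0 := fun h0 => det_realMatrix_ne_zero h (by
    rw [← Int.cast_det, h0, Int.cast_zero])
  have h2 : (Q * P - (q : ℤ) • 1) * Q = 0 := by
    rw [sub_mul, ← h1, Matrix.mul_smul, Matrix.smul_mul, Matrix.mul_one, Matrix.one_mul, sub_self]
  have h3 := congrArg (· * Q.adjugate) h2
  simp only [Matrix.mul_assoc, mul_adjugate, Matrix.zero_mul, Matrix.mul_smul,
    Matrix.mul_one] at h3
  exact sub_eq_zero.mp ((smul_eq_zero_iff_right hQ).mp h3)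

theorem span_lattice (h : P * Q = (q : ℤ) • 1) :
    Submodule.span ℝ (lattice (realMatrix Q)) = ⊤ := by
  refine eq_top_iff.mpr fun y _ => ?_
  have hu := (det_realMatrix_ne_zero h).isUnit
  have hy : y = ∑ i, ((realMatrix Q)⁻¹ *ᵥ y.ofLp) i •
      WithLp.toLp 2 (realMatrix Q *ᵥ realVec (Pi.single i 1)) := by
    apply (WithLp.equiv 2 (Fin n → ℝ)).injective
    change y.ofLp = _
    conv_lhs => rw [← one_mulVec y.ofLp, ← mul_nonsing_inv _ hu, ← mulVec_mulVec]
    ext j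
    simp only [WithLp.equiv_apply, WithLp.ofLp_sum, WithLp.ofLp_smul, Finset.sum_apply, Pi.smul_apply,
      smul_eq_mul]
    rw [mulVec, dotProduct]
    refine Finset.sum_congr rfl fun i _ => ?_
    have : realVec (Pi.single i (1 : ℤ)) = Pi.single i (1 : ℝ) := by
      ext k
      by_cases hk : k = i
      · subst hk; simp [realVec]
      · simp [realVec, hk]
    rw [this, mulVec_single_one, mul_comm]
    rfl
  rw [hy]
  exact Submodule.sum_mem _ fun i _ =>
    Submodule.smul_mem _ _ (Submodule.subset_span ⟨Pi.single i 1, rfl⟩)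

theorem inner_toLp {m : ℕ} (x y : Fin m → ℝ) :
    inner ℝ (WithLp.toLp 2 x) (WithLp.toLp 2 y) = x ⬝ᵥ y := by
  rw [EuclideanSpace.inner_toLp_toLp, star_trivial, dotProduct_comm]

theorem norm_toLp_sq {m : ℕ} (x : Fin m → ℝ) : ‖WithLp.toLp 2 x‖ ^ 2 = x ⬝ᵥ x := by
  rw [← real_inner_self_eq_norm_sq, inner_toLp]

theorem toLp_mem_dualLattice (h : P * Q = (q : ℤ) • 1) (y : Fin n → ℤ) :
    WithLp.toLp 2 ((realMatrix Q)⁻¹ᵀ *ᵥ realVec y) ∈ dualLattice (lattice (realMatrix Q)) := by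
  refine ⟨by rw [span_lattice h]; trivial, ?_⟩
  rintro _ ⟨z, rfl⟩
  refine ⟨z ⬝ᵥ y, ?_⟩
  rw [inner_toLp, dotProduct_mulVec, ← mulVec_transpose, transpose_transpose, mulVec_mulVec,
    nonsing_inv_mul _ (det_realMatrix_ne_zero h).isUnit, one_mulVec]
  simp [dotProduct, realVec]

theorem tsum_dual_le_gaussianSum (h : P * Q = (q : ℤ) • 1) (t : ℝ) :
    ∑' y : Fin n → ℤ, ENNReal.ofReal (Real.exp (-Real.pi * (t ^ 2 *
      (((realMatrix Q)⁻¹ᵀ *ᵥ realVec y) ⬝ᵥ ((realMatrix Q)⁻¹ᵀ *ᵥ realVec y))))) ≤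
    gaussianSum t (dualLattice (lattice (realMatrix Q))) := by
  have hinj : Function.Injective fun y : Fin n → ℤ =>
      (⟨_, toLp_mem_dualLattice h y⟩ : dualLattice (lattice (realMatrix Q))) := by
    intro y z hyz
    have h1 := congrArg (fun w : dualLattice (lattice (realMatrix Q)) =>
      (realMatrix Q)ᵀ *ᵥ w.1.ofLp) hyz
    simp only [mulVec_mulVec, ← transpose_mul,
      nonsing_inv_mul _ (det_realMatrix_ne_zero h).isUnit, transpose_one, one_mulVec] at h1
    ext i
    exact Int.cast_injective (α := ℝ) (congrFun h1 i)
  refine le_trans (le_of_eq (tsum_congr fun y => ?_))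
    (ENNReal.tsum_comp_le_tsum_of_injective hinj _)
  simp only [norm_smul, mul_pow, norm_toLp_sq, Real.norm_eq_abs, sq_abs]

/-- Rules out the default value `sInf ∅ = 0` of the smoothing parameter. Since `q eᵢ = Q (P eᵢ)`
lies in `L(Q)`, multiplication by `q` embeds the dual in `ℤⁿ`, where Gaussian sums are explicit. -/
theorem exists_gaussianSum_dualLattice_le (h : P * Q = (q : ℤ) • 1) {ε : ℝ} (hε : 0 < ε) :
    {t : ℝ | 0 < t ∧ gaussianSum t (dualLattice (lattice (realMatrix Q))) ≤
      ENNReal.ofReal (1 + ε)}.Nonempty := by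
  have hq : (0 : ℝ) < q := by exact_mod_cast Nat.pos_of_ne_zero (NeZero.ne q)
  have hint : ∀ y : dualLattice (lattice (realMatrix Q)), ∃ k : Fin n → ℤ,
      (q : ℝ) • y.1.ofLp = realVec k := fun y => by
    have h1 : ∀ i, ∃ k : ℤ, (q : ℝ) * y.1.ofLp i = k := fun i => by
      obtain ⟨k, hk⟩ := y.2.2 _ ⟨P *ᵥ Pi.single i 1, rfl⟩
      refine ⟨k, ?_⟩
      change inner ℝ (WithLp.toLp 2 (realMatrix Q *ᵥ realVec (P *ᵥ Pi.single i 1)))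
        (WithLp.toLp 2 y.1.ofLp) = _ at hk
      rw [inner_toLp, realMatrix_mulVec_realVec, mulVec_mulVec, mul_eq_smul_one_comm h,
        smul_mulVec, one_mulVec] at hk
      rw [← hk, dotProduct, Finset.sum_eq_single i]
      · simp [realVec]
      · intro j _ hj
        simp [realVec, hj]
      · simp
    choose k hk using h1
    exact ⟨k, funext hk⟩
  choose κ hκ using hint
  have hinj : Function.Injective κ := fun y z hyz => by
    have h1 : (q : ℝ) • y.1.ofLp = (q : ℝ) • z.1.ofLp := by rw [hκ, hκ, hyz]
    exact Subtype.ext ((WithLp.equiv 2 _).injective (smul_right_injective _ hq.ne' h1))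
  obtain ⟨b, hb0, hb1, hbn⟩ : ∃ b : ℝ, 0 < b ∧ b ≤ 3 / 4 ∧ 8 * (n * b) ≤ min (ε / 2) 1 := by
    have h0 : 0 < min (ε / 2) 1 := lt_min (by linarith) one_pos
    refine ⟨min (ε / 2) 1 / (8 * (n + 1)), by positivity, ?_, ?_⟩
    · rw [div_le_iff₀ (by positivity)]
      have := min_le_right (ε / 2) 1
      have : (0 : ℝ) ≤ n := n.cast_nonneg
      linarith
    · rw [← mul_assoc, mul_div_assoc', div_le_iff₀ (by positivity)]
      nlinarith
  have hlog : 0 < -Real.log b := neg_pos.mpr (Real.log_neg hb0 (by linarith))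
  have hexp : Real.exp (- -Real.log b) = b := by rw [neg_neg, Real.exp_log hb0]
  -- Chosen so that the weight of `y` is `b` to the power `‖q y‖²`.
  refine ⟨q * √(-Real.log b / Real.pi), by have := Real.pi_pos; positivity, ?_⟩
  have hsum := tsum_exp_neg_mul_sum_sq_le (n := n) (a := -Real.log b) (by rwa [hexp])
    (by rwa [hexp]) (min_le_right _ _)
  refine le_trans (le_trans (le_of_eq (tsum_congr fun y => ?_))
    (ENNReal.tsum_comp_le_tsum_of_injective hinj _)) (hsum.trans (ENNReal.ofReal_le_ofReal ?_))
  · congr 2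
    rw [norm_smul, mul_pow, Real.norm_eq_abs, sq_abs, mul_pow,
      Real.sq_sqrt (div_nonneg hlog.le Real.pi_pos.le), ← hκ, smul_dotProduct, dotProduct_smul,
      ← norm_toLp_sq]
    have := Real.pi_ne_zero
    field_simp
    simp
    ring
  · linarith [min_le_left (ε / 2) 1]

theorem gaussianSum_dualLattice_le (h : P * Q = (q : ℤ) • 1) {ε : ℝ} (hε : 0 < ε) {r : ℝ}
    (hr : smoothing ε (lattice (realMatrix Q)) ≤ r) :
    gaussianSum r (dualLattice (lattice (realMatrix Q))) ≤ ENNReal.ofReal (1 + ε) :=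
  gaussianSum_le_of_sInf_le (exists_gaussianSum_dualLattice_le h hε) hr

theorem integerLattice_eq (n : ℕ) :
    integerLattice n = lattice (realMatrix (1 : Matrix (Fin n) (Fin n) ℤ)) := by
  rw [integerLattice, realMatrix, Matrix.map_one _ Int.cast_zero Int.cast_one]

theorem dualLattice_integerLattice_subset (h : P * Q = (q : ℤ) • 1) :
    dualLattice (integerLattice n) ⊆ dualLattice (lattice (realMatrix Q)) := by
  rintro y ⟨-, hy⟩
  refine ⟨by rw [span_lattice h]; trivial, ?_⟩
  rintro _ ⟨z, rfl⟩
  refine hy _ ⟨Q *ᵥ z, ?_⟩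
  rw [one_mulVec]
  exact congrArg _ (realMatrix_mulVec_realVec Q z)

theorem smoothing_nonneg {m : ℕ} (ε : ℝ) (L : Set (EuclideanSpace ℝ (Fin m))) :
    0 ≤ smoothing ε L :=
  Real.sInf_nonneg fun _ ht => ht.1.le

/-- `L(Q) ⊆ ℤⁿ` reverses to an inclusion of duals, so `r` also smooths `ℤⁿ`. -/
theorem smoothing_integerLattice_le (h : P * Q = (q : ℤ) • 1) {ε : ℝ} (hε : 0 < ε) {r : ℝ}
    (hr : 0 < r) (hrQ : smoothing ε (lattice (realMatrix Q)) ≤ r) :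
    smoothing ε (integerLattice n) ≤ r :=
  csInf_le ⟨0, fun _ ht => ht.1.le⟩ ⟨hr, (ENNReal.tsum_mono_subtype
    (fun y => ENNReal.ofReal (Real.exp (-Real.pi * ‖r • y‖ ^ 2)))
    (dualLattice_integerLattice_subset h)).trans (gaussianSum_dualLattice_le h hε hrQ)⟩

theorem tsum_integer_smoothing_le (n : ℕ) {ε : ℝ} (hε : 0 < ε) :
    ∑' y : Fin n → ℤ, ENNReal.ofReal (Real.exp (-Real.pi *
      (smoothing ε (integerLattice n) ^ 2 * (realVec y ⬝ᵥ realVec y)))) ≤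
        ENNReal.ofReal (1 + ε) := by
  have h : (1 : Matrix (Fin n) (Fin n) ℤ) * 1 = ((1 : ℕ) : ℤ) • 1 := by simp
  have h1 := (tsum_dual_le_gaussianSum h (smoothing ε (integerLattice n))).trans
    (gaussianSum_dualLattice_le h hε (integerLattice_eq n ▸ le_rfl))
  have h2 : realMatrix (1 : Matrix (Fin n) (Fin n) ℤ) = 1 :=
    Matrix.map_one _ Int.cast_zero Int.cast_one
  simpa only [h2, inv_one, transpose_one, one_mulVec] using h1

/-! ### Gaussian sums over cosets -/

theorem posDef_inv_sq_smul (h : P * Q = (q : ℤ) • 1) {r : ℝ} (hr : 0 < r) :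
    ((r ^ 2)⁻¹ • ((realMatrix Q)ᵀ * realMatrix Q)).PosDef := by
  refine Matrix.PosDef.smul ?_ (by positivity : 0 < (r ^ 2)⁻¹)
  have := Matrix.PosDef.conjTranspose_mul_self (realMatrix Q) (mulVec_injective_of_isUnit
    ((isUnit_iff_isUnit_det _).mpr (det_realMatrix_ne_zero h).isUnit))
  rwa [conjTranspose_eq_transpose_of_trivial] at this

theorem tsum_gaussianWeight_gram_le (h : P * Q = (q : ℤ) • 1) {ε : ℝ} (hε : 0 < ε) {r : ℝ}
    (hr : 0 < r) (hrQ : smoothing ε (lattice (realMatrix Q)) ≤ r) :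
    ∑' y, gaussianWeight ((r ^ 2)⁻¹ • ((realMatrix Q)ᵀ * realMatrix Q)) y ≤
      ENNReal.ofReal (1 + ε) := by
  refine le_trans (le_of_eq (tsum_congr fun y => ?_))
    ((tsum_dual_le_gaussianSum h r).trans (gaussianSum_dualLattice_le h hε hrQ))
  have hu := (det_realMatrix_ne_zero h).isUnit
  have hinv : ((r ^ 2)⁻¹ • ((realMatrix Q)ᵀ * realMatrix Q))⁻¹ =
      r ^ 2 • ((realMatrix Q)⁻¹ * (realMatrix Q)⁻¹ᵀ) := by
    refine inv_eq_right_inv ?_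
    rw [smul_mul_smul_comm, inv_mul_cancel₀ (by positivity), one_smul, Matrix.mul_assoc,
      ← Matrix.mul_assoc (realMatrix Q), mul_nonsing_inv _ hu, Matrix.one_mul, ← transpose_mul,
      nonsing_inv_mul _ hu, transpose_one]
  rw [gaussianWeight, hinv, smul_mulVec, dotProduct_smul, ← mulVec_mulVec, dotProduct_mulVec,
    ← mulVec_transpose]
  rfl

theorem tsum_coset_gaussianWeight (h : P * Q = (q : ℤ) • 1) {r : ℝ} (hr : 0 < r)
    (c : Fin n → ℤ) :
    ∑' x, (cosetOf Q c).indicator (gaussianWeight (r ^ 2 • 1)) x =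
      ∑' z : Fin n → ℤ, ENNReal.ofReal (Real.exp (-Real.pi *
        (((realMatrix Q)⁻¹ *ᵥ realVec c + realVec z) ⬝ᵥ
          ((r ^ 2)⁻¹ • ((realMatrix Q)ᵀ * realMatrix Q)) *ᵥ
            ((realMatrix Q)⁻¹ *ᵥ realVec c + realVec z)))) := by
  have hc : cosetOf Q c = Set.range fun v => Q *ᵥ v + c := by
    ext x
    simp [cosetOf, eq_comm]
  have hinj : Function.Injective fun v => Q *ᵥ v + c :=
    (add_left_injective c).comp (mulVec_injective_of_mul_eq h)
  rw [← tsum_subtype, hc, tsum_range (gaussianWeight (r ^ 2 • 1)) hinj]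
  refine tsum_congr fun z => ?_
  have hu := (det_realMatrix_ne_zero h).isUnit
  have h1 : realVec (Q *ᵥ z + c) =
      realMatrix Q *ᵥ ((realMatrix Q)⁻¹ *ᵥ realVec c + realVec z) := by
    rw [mulVec_add, mulVec_mulVec, mul_nonsing_inv _ hu, one_mulVec, realMatrix_mulVec_realVec]
    ext i
    simp [realVec, add_comm]
  change ENNReal.ofReal (Real.exp (-Real.pi * (realVec (Q *ᵥ z + c) ⬝ᵥ
    (r ^ 2 • (1 : Matrix (Fin n) (Fin n) ℝ))⁻¹ *ᵥ realVec (Q *ᵥ z + c)))) = _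
  rw [h1, inv_sq_smul_one hr.ne', smul_mulVec, smul_mulVec, one_mulVec, dotProduct_smul,
    dotProduct_smul, ← mulVec_mulVec, dotProduct_mulVec _ (realMatrix Q)ᵀ, vecMul_transpose]

theorem exists_coset_gaussianWeight_bounds (h : P * Q = (q : ℤ) • 1) {ε : ℝ} (hε : 0 < ε) {r : ℝ}
    (hr : 0 < r) (hrQ : smoothing ε (lattice (realMatrix Q)) ≤ r) :
    ∃ K : ℝ, 0 < K ∧ ∀ c,
      ENNReal.ofReal (K * (1 - ε)) ≤
        ∑' x, (cosetOf Q c).indicator (gaussianWeight (r ^ 2 • 1)) x ∧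
      ∑' x, (cosetOf Q c).indicator (gaussianWeight (r ^ 2 • 1)) x ≤
        ENNReal.ofReal (K * (1 + ε)) := by
  obtain ⟨K, hK, hb⟩ := exists_tsum_gaussian_shift_bounds (posDef_inv_sq_smul h hr) hε.le
    (tsum_gaussianWeight_gram_le h hε hr hrQ)
  exact ⟨K, hK, fun c => by rw [tsum_coset_gaussianWeight h hr]; exact hb _⟩

end Lattice

/-! ### Statistical distance from a one-sided pointwise bound -/

theorem bind_apply_le {α β : Type*} {μ ν : PMF α} {C : ℝ≥0∞} (h : ∀ a, μ a ≤ C * ν a)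
    (f : α → PMF β) (b : β) : μ.bind f b ≤ C * ν.bind f b := by
  rw [PMF.bind_apply, PMF.bind_apply, ← ENNReal.tsum_mul_left]
  refine ENNReal.tsum_le_tsum fun a => ?_
  rw [← mul_assoc]
  gcongr
  exact h a

theorem bind_apply_le_of_forall {α β : Type*} (μ : PMF α) {C : ℝ≥0∞} {f g : α → PMF β}
    (h : ∀ a b, f a b ≤ C * g a b) (b : β) : μ.bind f b ≤ C * μ.bind g b := by
  rw [PMF.bind_apply, PMF.bind_apply, ← ENNReal.tsum_mul_left]
  refine ENNReal.tsum_le_tsum fun a => ?_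
  rw [mul_left_comm]
  gcongr
  exact h a b

theorem summable_toReal {α : Type*} (μ : PMF α) : Summable fun a => (μ a).toReal :=
  ENNReal.summable_toReal μ.tsum_coe_ne_top

theorem tsum_toReal {α : Type*} (μ : PMF α) : ∑' a, (μ a).toReal = 1 := by
  rw [← ENNReal.tsum_toReal_eq μ.apply_ne_top, μ.tsum_coe, ENNReal.toReal_one]

theorem statDist_le_one {α : Type*} (μ ν : PMF α) : statDist μ ν ≤ 1 := by
  have h1 := (summable_toReal μ).add (summable_toReal ν)
  have hle : ∀ a, |(μ a).toReal - (ν a).toReal| ≤ (μ a).toReal + (ν a).toReal := fun a =>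
    (abs_sub _ _).trans (by rw [abs_of_nonneg ENNReal.toReal_nonneg,
      abs_of_nonneg ENNReal.toReal_nonneg])
  have h2 := (Summable.of_nonneg_of_le (fun _ => abs_nonneg _) hle h1).tsum_le_tsum hle h1
  rw [(summable_toReal μ).tsum_add (summable_toReal ν), tsum_toReal, tsum_toReal] at h2
  rw [statDist]
  linarith

/-- Pointwise `|μ - ν| ≤ (ν - μ) + 2 δ ν`, and `ν - μ` sums to zero. -/
theorem statDist_le_of_apply_le {α : Type*} {μ ν : PMF α} {δ : ℝ} (hδ : 0 ≤ δ)
    (h : ∀ a, μ a ≤ ENNReal.ofReal (1 + δ) * ν a) : statDist μ ν ≤ δ := by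
  have hr : ∀ a, (μ a).toReal ≤ (1 + δ) * (ν a).toReal := fun a => by
    have := ENNReal.toReal_mono (ENNReal.mul_ne_top ENNReal.ofReal_ne_top (ν.apply_ne_top a)) (h a)
    rwa [ENNReal.toReal_mul, ENNReal.toReal_ofReal (by linarith)] at this
  have hle : ∀ a, |(μ a).toReal - (ν a).toReal| ≤
      (ν a).toReal - (μ a).toReal + 2 * δ * (ν a).toReal := fun a => by
    have h0 : 0 ≤ (ν a).toReal := ENNReal.toReal_nonneg
    have h1 := hr a
    have h2 := mul_nonneg hδ h0
    rw [abs_le]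
    constructor <;> linarith
  have hμ := summable_toReal μ
  have hν := summable_toReal ν
  have hs := (hν.sub hμ).add (hν.mul_left (2 * δ))
  have h2 := (Summable.of_nonneg_of_le (fun _ => abs_nonneg _) hle hs).tsum_le_tsum hle hs
  rw [(hν.sub hμ).tsum_add (hν.mul_left _), hν.tsum_sub hμ, tsum_mul_left, tsum_toReal,
    tsum_toReal] at h2
  rw [statDist]
  linarith

/-! ### Gaussian convolution -/

theorem discreteGaussian_apply {m : ℕ} {C : Matrix (Fin m) (Fin m) ℝ} (hC : C.PosDef)
    {S : Set (Fin m → ℤ)} (hS : S.Nonempty) (x : Fin m → ℤ) :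
    discreteGaussian C hC S hS x =
      S.indicator (gaussianWeight C) x / ∑' y, S.indicator (gaussianWeight C) y := by
  rw [discreteGaussian, PMF.normalize_apply, div_eq_mul_inv]

theorem gaussianWeight_pos {m : ℕ} (C : Matrix (Fin m) (Fin m) ℝ) (x : Fin m → ℤ) :
    0 < gaussianWeight C x := ENNReal.ofReal_pos.mpr (Real.exp_pos _)

theorem tsum_gaussianWeight_pos {m : ℕ} (C : Matrix (Fin m) (Fin m) ℝ) :
    0 < ∑' x, gaussianWeight C x :=
  (gaussianWeight_pos C 0).trans_le (ENNReal.le_tsum 0)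

/-- A distribution whose density with respect to the weight `w` lies in `[a, b]`. -/
theorem apply_le_of_density_bounds {α : Type*} {μ : PMF α} {w F : α → ℝ≥0∞} {a b D : ℝ≥0∞}
    (ha0 : a ≠ 0) (ha : a ≠ ∞) (hD0 : D ≠ 0) (hD : D ≠ ∞)
    (h : ∀ x, μ x = w x * F x / D) (hFa : ∀ x, a ≤ F x) (hFb : ∀ x, F x ≤ b)
    (x : α) : μ x ≤ b / a * (w x / ∑' y, w y) := by
  -- Total mass one forces `D = ∑ w F`, so the normaliser needs no separate evaluation.
  have h1 : a * ∑' y, w y ≤ D := by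
    have h2 : ∑' y, w y * F y = D := by
      have := μ.tsum_coe
      simp_rw [h, div_eq_mul_inv] at this
      rw [ENNReal.tsum_mul_right] at this
      rw [← one_mul D, ← this, mul_assoc, ENNReal.inv_mul_cancel hD0 hD, mul_one]
    rw [← h2, ← ENNReal.tsum_mul_left]
    refine ENNReal.tsum_le_tsum fun y => ?_
    rw [mul_comm]
    gcongr
    exact hFa y
  rw [h]
  calc w x * F x / D ≤ w x * b / (a * ∑' y, w y) := by
        gcongr
        exact hFb x
    _ = _ := by
        rw [div_eq_mul_inv, div_eq_mul_inv, div_eq_mul_inv,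
          ENNReal.mul_inv (Or.inl ha0) (Or.inl ha)]
        ring

theorem perturbationCov_eq {m n : ℕ} (T : Matrix (Fin m) (Fin n) ℤ) (r s : ℝ) :
    perturbationCov T r s = s ^ 2 • 1 - r ^ 2 • (realMatrix T * (realMatrix T)ᵀ) := rfl

theorem gaussianWeight_smul_one {m : ℕ} {r : ℝ} (hr : 0 < r) (x : Fin m → ℤ) :
    gaussianWeight (r ^ 2 • 1) x =
      ENNReal.ofReal (Real.exp (-Real.pi * ((r ^ 2)⁻¹ * (realVec x ⬝ᵥ realVec x)))) := by
  change ENNReal.ofReal (Real.exp (-Real.pi * (realVec x ⬝ᵥ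
    (r ^ 2 • (1 : Matrix (Fin m) (Fin m) ℝ))⁻¹ *ᵥ realVec x))) = _
  rw [inv_sq_smul_one hr.ne', smul_mulVec, one_mulVec, dotProduct_smul, smul_eq_mul]

/-- The law of `p + T x'` for `p ← D_{ℤᵐ, √Σ_p}` and `x' ← D_{ℤⁿ, r}`. -/
def convolution {m n : ℕ} (T : Matrix (Fin m) (Fin n) ℤ) {r s : ℝ} (hr : 0 < r)
    (hC : (perturbationCov T r s).PosDef) : PMF (Fin m → ℤ) :=
  (discreteGaussian (perturbationCov T r s) hC Set.univ Set.univ_nonempty).bind fun p =>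
    (sphericalGaussian r hr Set.univ Set.univ_nonempty).map fun v => p + T *ᵥ v

/-- For each `v` exactly one `p`, namely `x - T v`, lands on `x`; completing the square then
extracts the weight of `x`. -/
theorem convolution_apply {m n : ℕ} {T : Matrix (Fin m) (Fin n) ℤ} {r s : ℝ} (hr : 0 < r)
    (hs : 0 < s) (hC : (perturbationCov T r s).PosDef) (x : Fin m → ℤ) :
    convolution T hr hC x = gaussianWeight (s ^ 2 • 1) x * (∑' z : Fin n → ℤ, ENNReal.ofReal
      (Real.exp (-Real.pi * ((-(r ^ 2 / s ^ 2) • ((realMatrix T)ᵀ *ᵥ realVec x) + realVec z) ⬝ᵥ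
        fiberPrecision (realMatrix T) (perturbationCov T r s) r *ᵥ
          (-(r ^ 2 / s ^ 2) • ((realMatrix T)ᵀ *ᵥ realVec x) + realVec z))))) /
      ((∑' p, gaussianWeight (perturbationCov T r s) p) *
        ∑' v : Fin n → ℤ, gaussianWeight (r ^ 2 • 1) v) := by
  classical
  have hZp := tsum_gaussianWeight_pos (perturbationCov T r s)
  have hZp' := tsum_gaussianWeight_ne_top hC
  rw [convolution, PMF.bind_apply]
  simp_rw [PMF.map_apply, sphericalGaussian, discreteGaussian_apply, Set.indicator_univ]
  generalize ∑' v : Fin n → ℤ, gaussianWeight (r ^ 2 • 1) v = Zr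
  generalize ∑' p : Fin m → ℤ, gaussianWeight (perturbationCov T r s) p = Zp at *
  simp_rw [← ENNReal.tsum_mul_left]
  rw [ENNReal.tsum_comm, div_eq_mul_inv, ← ENNReal.tsum_mul_right]
  refine tsum_congr fun v => ?_
  rw [tsum_eq_single (x - T *ᵥ v)]
  swap
  · intro p hp
    rw [if_neg, mul_zero]
    intro h
    exact hp (by rw [h]; abel)
  rw [if_pos (by abel), ENNReal.mul_inv (Or.inl hZp.ne') (Or.inl hZp'), div_eq_mul_inv,
    div_eq_mul_inv, mul_mul_mul_comm]
  congr 1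
  rw [gaussianWeight_smul_one hr, gaussianWeight_smul_one hs]
  change ENNReal.ofReal (Real.exp (-Real.pi * (realVec (x - T *ᵥ v) ⬝ᵥ
    (perturbationCov T r s)⁻¹ *ᵥ realVec (x - T *ᵥ v)))) * _ = _
  have h1 : realVec (x - T *ᵥ v) = realVec x - realMatrix T *ᵥ realVec v := by
    rw [realMatrix_mulVec_realVec]
    ext i
    simp [realVec]
  rw [← ENNReal.ofReal_mul (Real.exp_pos _).le, ← ENNReal.ofReal_mul (Real.exp_pos _).le,
    ← Real.exp_add, ← Real.exp_add, ← mul_add, ← mul_add, h1, add_comm]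
  exact congrArg (fun t => ENNReal.ofReal (Real.exp (-Real.pi * t)))
    (gaussian_fiber_complete_square hr hs hC (realVec x) (realVec v))

theorem norm_sq_mulVec_le {m n : ℕ} (T : Matrix (Fin m) (Fin n) ℝ) (v : Fin n → ℝ) :
    (T *ᵥ v) ⬝ᵥ (T *ᵥ v) ≤ s₁ T ^ 2 * (v ⬝ᵥ v) := by
  have h := (Matrix.toEuclideanLin T).toContinuousLinearMap.le_opNorm (WithLp.toLp 2 v)
  have h1 := pow_le_pow_left₀ (norm_nonneg _) h 2
  rw [mul_pow] at h1
  change ‖WithLp.toLp 2 (T *ᵥ v)‖ ^ 2 ≤ s₁ T ^ 2 * ‖WithLp.toLp 2 v‖ ^ 2 at h1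
  rwa [norm_toLp_sq, norm_toLp_sq] at h1

theorem ofReal_div_le {K x ε : ℝ} (hK : 0 < K) (hx : ε ≤ x) (hx2 : x ≤ 1 / 2) (hε : 0 ≤ ε) :
    ENNReal.ofReal (K * (1 + ε)) / ENNReal.ofReal (K * (1 - ε)) ≤ ENNReal.ofReal (1 + 4 * x) := by
  rw [← ENNReal.ofReal_div_of_pos (mul_pos hK (by linarith))]
  refine ENNReal.ofReal_le_ofReal ?_
  rw [mul_div_mul_left _ _ hK.ne', div_le_iff₀ (by linarith)]
  nlinarith

theorem convolution_apply_le {m n : ℕ} {T : Matrix (Fin m) (Fin n) ℤ} {r s η τ : ℝ} (hr : 0 < r)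
    (hs : 0 < s) (hη : 0 ≤ η) (hηr : η ≤ r)
    (hsr : (r ^ 2 + η ^ 2) * (s₁ (realMatrix T) ^ 2 + 1) ≤ s ^ 2)
    (hC : (perturbationCov T r s).PosDef) (hτ0 : 0 ≤ τ) (hτ : τ ≤ 1 / 2)
    (h : ∑' z : Fin n → ℤ, ENNReal.ofReal
      (Real.exp (-(Real.pi * η ^ 2 / 2) * (realVec z ⬝ᵥ realVec z))) ≤ ENNReal.ofReal (1 + τ))
    (x : Fin m → ℤ) :
    convolution T hr hC x ≤ ENNReal.ofReal (1 + 4 * τ) *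
      sphericalGaussian s hs Set.univ Set.univ_nonempty x := by
  have hM := posDef_fiberPrecision (realMatrix T) hC hr
  obtain ⟨K, hK, hb⟩ := exists_tsum_gaussian_shift_bounds hM hτ0
    (le_trans (ENNReal.tsum_le_tsum fun y => ENNReal.ofReal_le_ofReal (Real.exp_le_exp.mpr (by
      have := mul_le_mul_of_nonneg_left (le_dotProduct_inv_fiberPrecision hr hη hηr
        (norm_sq_mulVec_le (realMatrix T)) hsr (realVec y)) Real.pi_pos.le
      change -Real.pi * (realVec y ⬝ᵥ (fiberPrecision (realMatrix T)
        (perturbationCov T r s) r)⁻¹ *ᵥ realVec y) ≤ _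
      rw [perturbationCov_eq]
      linarith))) h)
  have hpos : 0 < K * (1 - τ) := mul_pos hK (by linarith)
  have h1 := apply_le_of_density_bounds (ENNReal.ofReal_pos.mpr hpos).ne' ENNReal.ofReal_ne_top
    (mul_ne_zero (tsum_gaussianWeight_pos _).ne' (tsum_gaussianWeight_pos _).ne')
    (ENNReal.mul_ne_top (tsum_gaussianWeight_ne_top hC)
      (tsum_gaussianWeight_ne_top (posDef_sq_smul_one hr)))
    (convolution_apply hr hs hC) (fun x => (hb _).1) (fun x => (hb _).2) x
  refine h1.trans ?_
  rw [sphericalGaussian, discreteGaussian_apply, Set.indicator_univ]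
  gcongr
  exact ofReal_div_le hK le_rfl hτ hτ0

/-! ### The gadget sampler on a uniform target -/

theorem bind_congr_support {α β : Type*} (μ : PMF α) {f g : α → PMF β}
    (h : ∀ a, μ a ≠ 0 → f a = g a) : μ.bind f = μ.bind g := by
  ext b
  rw [PMF.bind_apply, PMF.bind_apply]
  refine tsum_congr fun a => ?_
  by_cases ha : μ a = 0
  · rw [ha, zero_mul, zero_mul]
  · rw [h a ha]

theorem uniformOfFintype_bind_equiv {α β : Type*} [Fintype α] [Nonempty α] (e : α ≃ α)
    (f : α → PMF β) :
    (PMF.uniformOfFintype α).bind f = (PMF.uniformOfFintype α).bind fun a => f (e a) := by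
  ext b
  rw [PMF.bind_apply, PMF.bind_apply, ← e.tsum_eq]
  simp only [PMF.uniformOfFintype_apply]

theorem reduce_add_smul {n : ℕ} (q : ℕ) (y w : Fin n → ℤ) :
    reduce q (y + (q : ℤ) • w) = reduce q y := by
  ext i
  simp [reduce]

theorem smul_eq_mulVec {n q : ℕ} {P Q : Matrix (Fin n) (Fin n) ℤ} (h : P * Q = (q : ℤ) • 1) (w : Fin n → ℤ) :
    (q : ℤ) • w = P *ᵥ (Q *ᵥ w) := by
  rw [mulVec_mulVec, h, smul_mulVec, one_mulVec]

theorem reduce_add {k : ℕ} (q : ℕ) (x y : Fin k → ℤ) : reduce q (x + y) = reduce q x + reduce q y := by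
  ext i
  simp [reduce]

theorem reduce_mulVec {k l : ℕ} (q : ℕ) (T : Matrix (Fin k) (Fin l) ℤ) (x : Fin l → ℤ) :
    reduce q (T *ᵥ x) = T.map (Int.cast : ℤ → ZMod q) *ᵥ reduce q x := by
  ext i
  simp [reduce, mulVec, dotProduct]

section Gadget

variable {n q : ℕ} [NeZero q] {P Q : Matrix (Fin n) (Fin n) ℤ}

theorem reduce_lift (v : Fin n → ZMod q) : reduce q (lift v) = v := by
  ext i
  simp [reduce, lift]

theorem exists_lift_reduce (y : Fin n → ℤ) : ∃ w : Fin n → ℤ,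
    lift (reduce q y) = y + (q : ℤ) • w := by
  refine ⟨fun i => -(y i / q), funext fun i => ?_⟩
  simp only [lift, reduce, Pi.add_apply, Pi.smul_apply, smul_eq_mul]
  rw [ZMod.val_intCast, Int.emod_def]
  ring

/-- For `x = Q w + c` one has `P x = q w + P c`, and `P c` is the target minus its error. So the
sample and the error determine the target. -/
theorem eq_reduce_of_mem_coset (h : P * Q = (q : ℤ) • 1) (dec : Decoder P) (v : Fin n → ZMod q)
    {x : Fin n → ℤ} (hx : x ∈ cosetOf Q (dec.coeff (lift v))) :
    v = reduce q (dec.err (lift v) + P *ᵥ x) := by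
  obtain ⟨w, rfl⟩ := hx
  rw [mulVec_add, ← smul_eq_mulVec h, ← dec.decode, show dec.err (lift v) + ((q : ℤ) • w +
    (lift v - dec.err (lift v))) = lift v + (q : ℤ) • w by abel, reduce_add_smul, reduce_lift]

/-- The converse: every `x` lies in the coset of the target `e + P x`, which has the same error `e`.
Together the two facts show that the cosets of the targets with a given error partition `ℤⁿ`. -/
theorem err_and_mem_coset_reduce (h : P * Q = (q : ℤ) • 1) (dec : Decoder P) (u x : Fin n → ℤ) :
    dec.err (lift (reduce q (dec.err u + P *ᵥ x))) = dec.err u ∧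
      x ∈ cosetOf Q (dec.coeff (lift (reduce q (dec.err u + P *ᵥ x)))) := by
  obtain ⟨w, hw⟩ := exists_lift_reduce (q := q) (dec.err u + P *ᵥ x)
  rw [hw]
  have he : dec.err (dec.err u + P *ᵥ x + (q : ℤ) • w) = dec.err u := by
    refine (congrArg dec.err ?_).trans (dec.err_coset u (-dec.coeff u + x + Q *ᵥ w))
    rw [mulVec_add, mulVec_add, mulVec_neg, ← dec.decode, smul_eq_mulVec h]
    abel
  refine ⟨he, -w, ?_⟩
  have hd := dec.decode (dec.err u + P *ᵥ x + (q : ℤ) • w)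
  rw [he, smul_eq_mulVec h, show dec.err u + P *ᵥ x + P *ᵥ (Q *ᵥ w) - dec.err u =
    P *ᵥ (x + Q *ᵥ w) by rw [mulVec_add]; abel] at hd
  rw [smul_eq_mulVec h, ← mulVec_injective_of_mul_eq (mul_eq_smul_one_comm h) hd, mulVec_neg]
  abel

/-- The joint law of the gadget sample and the decoding error for a uniform target. -/
def gadgetJoint (dec : Decoder P) (Q : Matrix (Fin n) (Fin n) ℤ) (q : ℕ) [NeZero q] (r : ℝ)
    (hr : 0 < r) : PMF ((Fin n → ℤ) × (Fin n → ℤ)) :=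
  (PMF.uniformOfFintype (Fin n → ZMod q)).bind fun v =>
    (gadgetSample dec Q r hr v).map fun x => (x, dec.err (lift v))

/-- The joint law of independent samples from `D_{ℤⁿ, r}` and from the error distribution. -/
def idealJoint (dec : Decoder P) (q : ℕ) [NeZero q] (r : ℝ) (hr : 0 < r) :
    PMF ((Fin n → ℤ) × (Fin n → ℤ)) :=
  (sphericalGaussian r hr Set.univ Set.univ_nonempty).bind fun x =>
    (errorDist q dec).map fun e => (x, e)

theorem idealJoint_apply (dec : Decoder P) {r : ℝ} (hr : 0 < r) (x e : Fin n → ℤ) :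
    idealJoint dec q r hr (x, e) =
      sphericalGaussian r hr Set.univ Set.univ_nonempty x * errorDist q dec e := by
  classical
  rw [idealJoint, PMF.bind_apply, tsum_eq_single x, PMF.map_apply, tsum_eq_single e]
  · simp
  · intro e' he
    simp [he.symm]
  · intro x' hx
    rw [PMF.map_apply]
    simp [hx.symm]

theorem gadgetJoint_apply (dec : Decoder P) {r : ℝ} (hr : 0 < r) (x e : Fin n → ℤ)
    [DecidableEq (Fin n → ℤ)] :
    gadgetJoint dec Q q r hr (x, e) = ∑' v : Fin n → ZMod q,
      PMF.uniformOfFintype (Fin n → ZMod q) v *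
        if e = dec.err (lift v) then gadgetSample dec Q r hr v x else 0 := by
  classical
  rw [gadgetJoint, PMF.bind_apply]
  refine tsum_congr fun v => ?_
  rw [PMF.map_apply, tsum_eq_single x]
  · congr 1
    simp
  · intro x' hx
    simp [hx.symm]

theorem tsum_gaussianWeight_le_card_mul (h : P * Q = (q : ℤ) • 1) (dec : Decoder P) {r : ℝ}
    {b : ℝ≥0∞}
    (hb : ∀ c, ∑' x, (cosetOf Q c).indicator (gaussianWeight (r ^ 2 • 1)) x ≤ b)
    (u : Fin n → ℤ) [DecidableEq (Fin n → ℤ)] :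
    ∑' x : Fin n → ℤ, gaussianWeight (r ^ 2 • 1) x ≤
      (Finset.univ.filter fun v : Fin n → ZMod q => dec.err u = dec.err (lift v)).card * b := by
  set F := Finset.univ.filter fun v : Fin n → ZMod q => dec.err u = dec.err (lift v) with hF
  calc _ ≤ ∑' x : Fin n → ℤ, ∑ v ∈ F,
        (cosetOf Q (dec.coeff (lift v))).indicator (gaussianWeight (r ^ 2 • 1)) x := by
        refine ENNReal.tsum_le_tsum fun x => ?_
        obtain ⟨h1, h2⟩ := err_and_mem_coset_reduce h dec u x
        refine le_trans (le_of_eq (Set.indicator_of_mem h2 _).symm) (Finset.single_le_sum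
          (f := fun v => (cosetOf Q (dec.coeff (lift v))).indicator
            (gaussianWeight (r ^ 2 • 1)) x) (fun _ _ => zero_le) ?_)
        rw [hF, Finset.mem_filter]
        exact ⟨Finset.mem_univ _, h1.symm⟩
    _ = ∑ v ∈ F, ∑' x : Fin n → ℤ,
        (cosetOf Q (dec.coeff (lift v))).indicator (gaussianWeight (r ^ 2 • 1)) x :=
        Summable.tsum_finsetSum fun _ _ => ENNReal.summable
    _ ≤ ∑ _v ∈ F, b := Finset.sum_le_sum fun v _ => hb _
    _ = _ := by rw [Finset.sum_const, nsmul_eq_mul]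

/-- At `(x, e)` a single target contributes, giving at most `U G / a`. The ideal law gives `(G / Z)
|F| U`, where `F` is the set of targets with error `e`, and `Z ≤ |F| b` because their cosets cover
`ℤⁿ`. -/
theorem gadgetJoint_apply_le (h : P * Q = (q : ℤ) • 1) (dec : Decoder P) {r : ℝ} (hr : 0 < r)
    {a b : ℝ≥0∞}
    (hab : ∀ c, a ≤ ∑' x, (cosetOf Q c).indicator (gaussianWeight (r ^ 2 • 1)) x ∧
      ∑' x, (cosetOf Q c).indicator (gaussianWeight (r ^ 2 • 1)) x ≤ b)
    (xe : (Fin n → ℤ) × (Fin n → ℤ)) :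
    gadgetJoint dec Q q r hr xe ≤ b / a * idealJoint dec q r hr xe := by
  classical
  obtain ⟨x, e⟩ := xe
  rw [gadgetJoint_apply, idealJoint_apply]
  by_cases hu : ∃ u : Fin n → ZMod q, e = dec.err (lift u)
  swap
  · rw [ENNReal.tsum_eq_zero.mpr fun v => ?_]
    · exact zero_le
    · rw [if_neg fun hv => hu ⟨v, hv⟩, mul_zero]
  obtain ⟨u, rfl⟩ := hu
  set F := Finset.univ.filter fun v : Fin n → ZMod q => dec.err (lift u) = dec.err (lift v) with hF
  set U : ℝ≥0∞ := (Fintype.card (Fin n → ZMod q) : ℝ≥0∞)⁻¹ with hU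
  set G := gaussianWeight (r ^ 2 • (1 : Matrix (Fin n) (Fin n) ℝ)) x with hG
  set Z := ∑' y : Fin n → ℤ, gaussianWeight (r ^ 2 • 1) y with hZ
  have hZ0 : Z ≠ 0 := (tsum_gaussianWeight_pos _).ne'
  have hZt : Z ≠ ∞ := tsum_gaussianWeight_ne_top (posDef_sq_smul_one hr)
  have hχ : errorDist q dec (dec.err (lift u)) = F.card * U := by
    rw [errorDist, PMF.map_apply, tsum_fintype]
    simp only [PMF.uniformOfFintype_apply]
    rw [← Finset.sum_filter, Finset.sum_const, nsmul_eq_mul]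
  have h1 : ∑' v : Fin n → ZMod q, PMF.uniformOfFintype (Fin n → ZMod q) v *
      (if dec.err (lift u) = dec.err (lift v) then gadgetSample dec Q r hr v x else 0) ≤
      U * (G / a) := by
    rw [← tsum_ite_eq (reduce q (dec.err (lift u) + P *ᵥ x)) (fun _ => U * (G / a))]
    refine ENNReal.tsum_le_tsum fun v => ?_
    rw [PMF.uniformOfFintype_apply]
    by_cases hv : dec.err (lift u) = dec.err (lift v)
    · rw [if_pos hv, gadgetSample, sphericalGaussian, discreteGaussian_apply]
      by_cases hx : x ∈ cosetOf Q (dec.coeff (lift v))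
      · rw [if_pos (by rw [hv]; exact eq_reduce_of_mem_coset h dec v hx),
          Set.indicator_of_mem hx]
        gcongr
        exact (hab _).1
      · rw [Set.indicator_of_notMem hx, ENNReal.zero_div, mul_zero]
        exact zero_le
    · rw [if_neg hv, mul_zero]
      exact zero_le
  refine h1.trans ?_
  rw [sphericalGaussian, discreteGaussian_apply, Set.indicator_univ, hχ]
  have h2 : 1 ≤ F.card * b / Z := by
    rw [ENNReal.le_div_iff_mul_le (Or.inl hZ0) (Or.inl hZt), one_mul]
    exact tsum_gaussianWeight_le_card_mul h dec (fun c => (hab c).2) (lift u)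
  calc U * (G / a) = U * (G / a) * 1 := (mul_one _).symm
    _ ≤ U * (G / a) * (F.card * b / Z) := by gcongr
    _ = _ := by
      simp only [div_eq_mul_inv]
      ring

end Gadget

/-! ### The two transcripts -/

section Transcript

variable {m n q : ℕ} [NeZero q] {P Q : Matrix (Fin n) (Fin n) ℤ}

/-- The transcript determined by a preimage and an error. -/
def transcript (A : Matrix (Fin n) (Fin m) (ZMod q)) (x : Fin m → ℤ) (e : Fin n → ℤ) :
    Transcript m n q :=
  (A, x, A *ᵥ reduce q x + reduce q e, reduce q e)

theorem simulatedDist_eq (dec : Decoder P) (A : Matrix (Fin n) (Fin m) (ZMod q)) (s : ℝ)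
    (hs : 0 < s) : simulatedDist dec A s hs =
      (sphericalGaussian s hs Set.univ Set.univ_nonempty).bind fun x =>
        (errorDist q dec).bind fun e => PMF.pure (transcript A x e) := rfl

theorem realDist_eq (h : P * Q = (q : ℤ) • 1) (dec : Decoder P)
    {A : Matrix (Fin n) (Fin m) (ZMod q)} {T : Matrix (Fin m) (Fin n) ℤ}
    (hA : A * T.map (Int.cast : ℤ → ZMod q) = P.map (Int.cast : ℤ → ZMod q)) {r s : ℝ}
    (hr : 0 < r) (hC : (perturbationCov T r s).PosDef) :
    realDist dec Q A T r s hr hC =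
      (discreteGaussian (perturbationCov T r s) hC Set.univ Set.univ_nonempty).bind fun p =>
        (gadgetJoint dec Q q r hr).bind fun xe =>
          PMF.pure (transcript A (p + T *ᵥ xe.1) xe.2) := by
  change (PMF.uniformOfFintype (Fin n → ZMod q)).bind (fun u =>
    ((discreteGaussian (perturbationCov T r s) hC Set.univ Set.univ_nonempty).bind fun p =>
      (gadgetSample dec Q r hr (u - A *ᵥ reduce q p)).bind fun x' =>
        PMF.pure (p + T *ᵥ x')).bind fun x =>
          PMF.pure (A, x, u, u - A *ᵥ reduce q x)) = _
  simp only [PMF.bind_bind, PMF.pure_bind]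
  rw [PMF.bind_comm]
  congr 1
  funext p
  -- Substitutes `u = v + A p`, a bijection for fixed `p`.
  rw [uniformOfFintype_bind_equiv (Equiv.addRight (A *ᵥ reduce q p)), gadgetJoint, PMF.bind_bind]
  congr 1
  funext v
  simp only [Equiv.coe_addRight, add_sub_cancel_right, PMF.map, PMF.bind_bind,
    Function.comp_apply, PMF.pure_bind]
  refine bind_congr_support _ fun x' hx' => ?_
  have hmem : x' ∈ cosetOf Q (dec.coeff (lift v)) := by
    by_contra hx
    rw [gadgetSample, sphericalGaussian, discreteGaussian_apply, Set.indicator_of_notMem hx,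
      ENNReal.zero_div] at hx'
    exact hx' rfl
  have hv : v = reduce q (dec.err (lift v)) + A *ᵥ reduce q (T *ᵥ x') := by
    conv_lhs => rw [eq_reduce_of_mem_coset h dec v hmem]
    rw [reduce_add, reduce_mulVec, reduce_mulVec, mulVec_mulVec, hA]
  have hu : v + A *ᵥ reduce q p =
      A *ᵥ reduce q (p + T *ᵥ x') + reduce q (dec.err (lift v)) := by
    conv_lhs => rw [hv]
    rw [reduce_add, mulVec_add]
    abel
  rw [transcript, hu, add_sub_cancel_left]

theorem realDist_apply_le (h : P * Q = (q : ℤ) • 1) (dec : Decoder P)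
    {A : Matrix (Fin n) (Fin m) (ZMod q)} {T : Matrix (Fin m) (Fin n) ℤ}
    (hA : A * T.map (Int.cast : ℤ → ZMod q) = P.map (Int.cast : ℤ → ZMod q)) {r s : ℝ}
    (hr : 0 < r) (hs : 0 < s) (hC : (perturbationCov T r s).PosDef) {C₁ C₂ : ℝ≥0∞}
    (h1 : ∀ xe, gadgetJoint dec Q q r hr xe ≤ C₁ * idealJoint dec q r hr xe)
    (h2 : ∀ x, convolution T hr hC x ≤ C₂ * sphericalGaussian s hs Set.univ Set.univ_nonempty x)
    (t : Transcript m n q) :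
    realDist dec Q A T r s hr hC t ≤ C₁ * C₂ * simulatedDist dec A s hs t := by
  rw [realDist_eq h dec hA, simulatedDist_eq, mul_assoc]
  refine (bind_apply_le_of_forall _ (fun p => bind_apply_le h1 _) t).trans ?_
  gcongr
  -- With `e` now independent of `x'`, the transcript sees `p` and `x'` only through `p + T x'`.
  refine le_trans (le_of_eq ?_) (bind_apply_le h2 _ t)
  congr 1
  simp only [convolution, idealJoint, PMF.map, PMF.bind_bind, PMF.pure_bind, Function.comp_apply]

end Transcript

/-! ### Negligible functions -/

/-- `k ^ c * √f` is the square root of `k ^ (2 c) * f`. -/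
theorem Negligible.sqrt {f : ℕ → ℝ} (hf : Negligible f) : Negligible fun k => √(f k) := by
  intro c
  have h := (Real.continuous_sqrt.tendsto 0).comp (hf (2 * c))
  rw [Real.sqrt_zero] at h
  refine h.congr fun k => ?_
  rw [Function.comp_apply, Real.sqrt_mul (by positivity), mul_comm 2 c, pow_mul,
    Real.sqrt_sq (by positivity)]

theorem Negligible.natPolynomial_mul {f : ℕ → ℝ} (hf : Negligible f) (d : Polynomial ℕ) :
    Negligible fun k => ((d.eval k : ℕ) : ℝ) * f k := by
  refine (hf.polynomial_mul (d.map (Nat.castRingHom ℝ))).congr fun k => ?_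
  simp [Polynomial.eval_natCast_map]

end CompactGadget

end

/-! ### Assembly of the bounds. -/

theorem mainTheorem1 (ε : ℕ → ℝ) (hε0 : ∀ k, 0 < ε k) (hε1 : ∀ k, ε k < 1)
    (hε : CompactGadget.Negligible ε) (dim : Polynomial ℕ) :
    ∃ δ : ℕ → ℝ, CompactGadget.Negligible δ ∧
      ∀ (k n m q : ℕ) [NeZero q] (P Q : Matrix (Fin n) (Fin n) ℤ)
        (dec : CompactGadget.Decoder P)
        (A : Matrix (Fin n) (Fin m) (ZMod q)) (T : Matrix (Fin m) (Fin n) ℤ)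
        (r s : ℝ) (hr : 0 < r) (hs : 0 < s),
        n ≤ dim.eval k →
        P * Q = (q : ℤ) • (1 : Matrix (Fin n) (Fin n) ℤ) →
        A * T.map (Int.cast : ℤ → ZMod q) = P.map (Int.cast : ℤ → ZMod q) →
        (r ^ 2 + CompactGadget.smoothing (ε k) (CompactGadget.integerLattice n) ^ 2) *
            (CompactGadget.s₁ (T.map (Int.cast : ℤ → ℝ)) ^ 2 + 1) ≤ s ^ 2 →
        CompactGadget.smoothing (ε k)
            (CompactGadget.lattice (Q.map (Int.cast : ℤ → ℝ))) ≤ r →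
        ∃ hC : (CompactGadget.perturbationCov T r s).PosDef,
          CompactGadget.statDist
              (CompactGadget.realDist dec Q A T r s hr hC)
              (CompactGadget.simulatedDist dec A s hs) ≤ δ k := by
  -- Each replacement costs a factor `1 + 64 τ`, and `(1 + 64 τ)² ≤ 1 + 256 τ` for `τ ≤ 1/32`. The
  -- `+ 1` in `dim + 1` gives `N ≥ 1`, hence `ε ≤ τ`.
  have hneg : CompactGadget.Negligible fun k => 256 * √(((dim + 1).eval k : ℕ) * ε k) :=
    (hε.natPolynomial_mul (dim + 1)).sqrt.const_mul 256
  refine ⟨_, hneg, fun k n m q _ P Q dec A T r s hr hs hn hPQ hA hsr hrQ => ?_⟩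
  have hC : (CompactGadget.perturbationCov T r s).PosDef :=
    CompactGadget.posDef_perturbation hr (CompactGadget.norm_sq_mulVec_le _) hsr
  refine ⟨hC, ?_⟩
  have hε0 := hε0 k
  have hε1 := hε1 k
  set η := CompactGadget.smoothing (ε k) (CompactGadget.integerLattice n) with hη
  set N := (dim + 1).eval k with hN
  have hN1 : N = dim.eval k + 1 := by simp [hN]
  have hN1' : (1 : ℝ) ≤ N := by rw [hN1]; push_cast; linarith [(dim.eval k).cast_nonneg (α := ℝ)]
  set τ := √((N : ℝ) * ε k) with hτ
  have hτ0 : 0 ≤ τ := Real.sqrt_nonneg _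
  have hτ2 : τ ^ 2 = N * ε k := Real.sq_sqrt (by positivity)
  have hετ : ε k ≤ τ := by
    refine Real.le_sqrt_of_sq_le ?_
    nlinarith
  rcases le_or_gt (16 * τ) (1 / 2) with hsmall | hlarge
  swap
  -- For `τ > 1/32` the claimed bound exceeds one.
  · exact (CompactGadget.statDist_le_one _ _).trans (by linarith)
  have hhalf := CompactGadget.tsum_exp_half_le (n := n) (N := N) (a := Real.pi * η ^ 2)
    (by omega) hε1 hτ0 (by
      have := CompactGadget.tsum_integer_smoothing_le n hε0
      simpa only [mul_assoc, neg_mul] using this) hτ2.ge (by linarith)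
  obtain ⟨K, hK, hab⟩ := CompactGadget.exists_coset_gaussianWeight_bounds hPQ hε0 hr hrQ
  refine CompactGadget.statDist_le_of_apply_le (by positivity) fun t => ?_
  refine (CompactGadget.realDist_apply_le hPQ dec hA hr hs hC
    (CompactGadget.gadgetJoint_apply_le hPQ dec hr hab)
    (CompactGadget.convolution_apply_le hr hs (CompactGadget.smoothing_nonneg _ _)
      (CompactGadget.smoothing_integerLattice_le hPQ hε0 hr hrQ) hsr hC (by positivity) hsmall
      hhalf) t).trans ?_
  gcongr
  refine (mul_le_mul_left (CompactGadget.ofReal_div_le hK (by linarith : ε k ≤ 16 * τ) hsmall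
    hε0.le) _).trans ?_
  rw [← ENNReal.ofReal_mul (by positivity)]
  refine ENNReal.ofReal_le_ofReal ?_
  nlinarith
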